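/- Let $S$ be a set of $n \ge 5$ points in the plane in general position (no three points of $S$ are collinear). A plane spanning path on $S$ is a path with vertex set $S$ whose edges, drawn as straight line segments, do not cross, i.e. two distinct edges have no point in common except possibly a common endpoint. The flip graph $G_{\mathcal{P}}(S)$ has as vertices all plane spanning paths on $S$ (regarded as unoriented, i.e. identified with their edge sets), and two distinct paths with edge sets $E_1$ and $E_2$ are adjacent if and only if $E_2 = (E_1 \setminus \{e\}) \cup \{f\}$ for some edges $e, f$. Then $G_{\mathcal{P}}(S)$ contains no connected component with at most $7$ vertices. -/

import Mathlib

/-- The Euclidean plane. -/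
abbrev Plane : Type := EuclideanSpace ℝ (Fin 2)

/-- A finite point set in the plane is in general position if no three of its points are
collinear. -/
def GeneralPosition (S : Finset Plane) : Prop :=
  ∀ p ∈ S, ∀ q ∈ S, ∀ r ∈ S, p ≠ q → p ≠ r → q ≠ r → ¬ Collinear ℝ ({p, q, r} : Set Plane)

/-- A graph with vertex set `S`, drawn with straight line segments as edges, is plane if its edges
do not cross: two distinct edges have no point in common except possibly a common endpoint. -/
def IsPlaneGraph (S : Finset Plane) (G : SimpleGraph S) : Prop :=
  ∀ a b c d : S, G.Adj a b → G.Adj c d → s(a, b) ≠ s(c, d) →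
    segment ℝ (a : Plane) (b : Plane) ∩ segment ℝ (c : Plane) (d : Plane) ⊆
      ({(a : Plane), (b : Plane)} ∩ {(c : Plane), (d : Plane)} : Set Plane)

/-- A graph with vertex set `S` is a spanning path on `S` if it is a path through all the points
of `S`, i.e. isomorphic to the path graph on `|S|` vertices. -/
def IsSpanningPath (S : Finset Plane) (G : SimpleGraph S) : Prop :=
  Nonempty (SimpleGraph.pathGraph S.card ≃g G)

/-- The set of all plane spanning paths on `S`; a path is identified with its set of edges, so it
has no orientation. -/
abbrev PlaneSpanningPath (S : Finset Plane) : Type :=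
  {G : SimpleGraph S // IsSpanningPath S G ∧ IsPlaneGraph S G}

/-- `Q` arises from `P` by a flip: the edge set of `Q` is that of `P` with some edge `e` replaced
by some edge `f`. -/
def IsFlip (S : Finset Plane) (P Q : PlaneSpanningPath S) : Prop :=
  ∃ e f : Sym2 S, Q.1.edgeSet = (P.1.edgeSet \ {e}) ∪ {f}

/-- The flip graph of plane spanning paths on `S`: two distinct plane spanning paths are adjacent
if one of them can be transformed into the other by a single flip. -/
def pathFlipGraph (S : Finset Plane) : SimpleGraph (PlaneSpanningPath S) :=
  SimpleGraph.fromRel (IsFlip S)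

/-! If the end `u` of a plane spanning path can be joined to a vertex `y`, not its neighbour,
without crossing the path, then adding `u y` and deleting the edge `x y` that precedes `y` gives a
plane spanning path with end `x`. Such a rotation (`Rot`) is a flip that keeps the other end, and
its inverse is again a rotation. It suffices to find enough paths reachable by rotations.

Rotations come from visibility. If `u` does not see `q`, consider the first edge that the segment
from `u` to `q` meets. On each side of this segment, the vertex closest to it in angle, within the
triangle cut off by that edge, is visible (`exists_sees_of_not_sees`). So an end always has an
available vertex. If only one or two vertices are available, the start of the path can be rigid: a
single edge hides all remaining points (`third_of_unique_avail`, `fourth_of_hidden`).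

Keep the last vertex `v` fixed. Some path in reach allows two rotations (`exists_two_avail`). If
both resulting paths allow a further step, this gives five paths; otherwise one of them is a dead
end, and the rigidity yields five paths nearby (`five_of_leaf`). So `exists_five` gives five vertex
lists ending in `v`. Their reversals begin with `v`. Rotating each reversal at `v` gives five more
lists, distinct since this rotation can be undone knowing `v`, in which `v` is interior. These are
fifteen lists (`exists_fifteen`). A path has at most two vertex lists, so its component has at least
eight paths. -/

/-- Twice the signed area of the triangle `a b c`. -/
def area (a b c : ℝ × ℝ) : ℝ := (b.1 - a.1) * (c.2 - a.2) - (b.2 - a.2) * (c.1 - a.1)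

lemma area_rotate (a b c : ℝ × ℝ) : area b c a = area a b c := by unfold area; ring

lemma area_swap (a b c : ℝ × ℝ) : area b a c = -area a b c := by unfold area; ring

lemma area_swap_right (a b c : ℝ × ℝ) : area a c b = -area a b c := by unfold area; ring

@[simp] lemma area_self_left (a b : ℝ × ℝ) : area a a b = 0 := by unfold area; ring

@[simp] lemma area_self_right (a b : ℝ × ℝ) : area a b b = 0 := by unfold area; ring

@[simp] lemma area_self_outer (a b : ℝ × ℝ) : area a b a = 0 := by unfold area; ring

/-- The three-term Grassmann–Plücker relation. -/
lemma area_plucker (u a b c d : ℝ × ℝ) :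
    area u a b * area u c d - area u a c * area u b d + area u a d * area u b c = 0 := by
  unfold area; ring

lemma area_swap_coords (a b c : ℝ × ℝ) : area a.swap b.swap c.swap = -area a b c := by
  simp only [area, Prod.fst_swap, Prod.snd_swap]; ring

/-- The point dividing `a b` in the ratio `t : 1 - t`. -/
def divide (a b : ℝ × ℝ) (t : ℝ) : ℝ × ℝ := (a.1 + t * (b.1 - a.1), a.2 + t * (b.2 - a.2))

lemma area_divide (p q a b : ℝ × ℝ) (t : ℝ) :
    area p q (divide a b t) = (1 - t) * area p q a + t * area p q b := by
  simp only [area, divide]; ring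

lemma area_divide_mid (p q a b : ℝ × ℝ) (t : ℝ) :
    area p (divide a b t) q = (1 - t) * area p a q + t * area p b q := by
  simp only [area, divide]; ring

lemma exists_eq_divide {a b m : ℝ × ℝ} (h : area a b m = 0) (hab : a ≠ b) :
    ∃ t, m = divide a b t := by
  simp only [area] at h
  by_cases h1 : b.1 - a.1 = 0
  · have h2 : b.2 - a.2 ≠ 0 := fun h2 => hab (Prod.ext (by linarith) (by linarith))
    refine ⟨(m.2 - a.2) / (b.2 - a.2), Prod.ext ?_ ?_⟩
    · have : m.1 - a.1 = 0 := by
        rw [h1] at h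
        have : (b.2 - a.2) * (m.1 - a.1) = 0 := by linarith
        exact (mul_eq_zero.1 this).resolve_left h2
      simp only [divide, h1]; linarith
    · simp only [divide]; field_simp; ring
  · refine ⟨(m.1 - a.1) / (b.1 - a.1), Prod.ext ?_ ?_⟩
    · simp only [divide]; field_simp; ring
    · simp only [divide]; field_simp; linarith

/-- Two segments `a b` and `c d` cross in their interiors. -/
def Crosses (a b c d : ℝ × ℝ) : Prop :=
  area a b c * area a b d < 0 ∧ area c d a * area c d b < 0

lemma Crosses.symm {a b c d : ℝ × ℝ} (h : Crosses a b c d) : Crosses c d a b := ⟨h.2, h.1⟩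

lemma Crosses.swap_left {a b c d : ℝ × ℝ} (h : Crosses a b c d) : Crosses b a c d := by
  refine ⟨?_, by rw [mul_comm]; exact h.2⟩
  rw [area_swap a b c, area_swap a b d]; linarith [h.1]

lemma Crosses.swap_right {a b c d : ℝ × ℝ} (h : Crosses a b c d) : Crosses a b d c :=
  h.symm.swap_left.symm

/-- Reflection in the diagonal changes the sign of every `area`, hence preserves products of two. It
transfers an argument for one side of a segment to the other side. -/
lemma crosses_swap_coords (a b c d : ℝ × ℝ) :
    Crosses a.swap b.swap c.swap d.swap ↔ Crosses a b c d := by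
  simp only [Crosses, area_swap_coords, neg_mul_neg]

lemma not_crosses_share (a b c : ℝ × ℝ) : ¬ Crosses a b a c := fun h => by
  have := h.1; simp at this

/-! ### Points in general position and how segments between them meet. -/

section Configuration

variable {V : Type*}

/-- The points `φ v` are in general position. -/
def Generic (φ : V → ℝ × ℝ) : Prop :=
  ∀ a b c, a ≠ b → a ≠ c → b ≠ c → area (φ a) (φ b) (φ c) ≠ 0

lemma Generic.swap {φ : V → ℝ × ℝ} (hφ : Generic φ) : Generic (fun v => (φ v).swap) :=
  fun a b c h1 h2 h3 => by
    rw [area_swap_coords]; exact neg_ne_zero.2 (hφ a b c h1 h2 h3)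

lemma mul_neg_of_combination_eq_zero {x y t : ℝ} (h0 : 0 ≤ t) (h1 : t ≤ 1) (hx : x ≠ 0)
    (hy : y ≠ 0) (h : (1 - t) * x + t * y = 0) : x * y < 0 := by
  by_contra hn
  rcases lt_or_gt_of_ne hx with hx | hx <;> rcases lt_or_gt_of_ne hy with hy | hy
  · rcases h0.eq_or_lt with rfl | h0
    · linarith
    · nlinarith [mul_pos_of_neg_of_neg hx hy, mul_neg_of_pos_of_neg h0 hy]
  · exact hn (mul_neg_of_neg_of_pos hx hy)
  · exact hn (mul_neg_of_pos_of_neg hx hy)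
  · rcases h0.eq_or_lt with rfl | h0
    · linarith
    · nlinarith [mul_pos h0 hy]

/-- Segments without a common endpoint that meet are crossing. -/
lemma Generic.crosses_of_meet {φ : V → ℝ × ℝ} (hφ : Generic φ) {a b c d : V} (hab : a ≠ b)
    (hcd : c ≠ d) (hac : a ≠ c) (had : a ≠ d) (hbc : b ≠ c) (hbd : b ≠ d) {s t : ℝ}
    (hs0 : 0 ≤ s) (hs1 : s ≤ 1) (ht0 : 0 ≤ t) (ht1 : t ≤ 1)
    (h : divide (φ a) (φ b) s = divide (φ c) (φ d) t) : Crosses (φ a) (φ b) (φ c) (φ d) := by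
  constructor
  · refine mul_neg_of_combination_eq_zero ht0 ht1 (hφ _ _ _ hab hac hbc) (hφ _ _ _ hab had hbd) ?_
    rw [← area_divide, ← h, area_divide]; simp
  · refine mul_neg_of_combination_eq_zero hs0 hs1 (hφ _ _ _ hcd hac.symm had.symm)
      (hφ _ _ _ hcd hbc.symm hbd.symm) ?_
    rw [← area_divide, h, area_divide]; simp

/-- Two segments with exactly one common endpoint meet only there. -/
lemma Generic.eq_of_meet_share {φ : V → ℝ × ℝ} (hφ : Generic φ) {a b d : V} (hab : a ≠ b)
    (had : a ≠ d) (hbd : b ≠ d) {s t : ℝ}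
    (h : divide (φ a) (φ b) s = divide (φ a) (φ d) t) : s = 0 ∧ t = 0 := by
  constructor
  · have : area (φ a) (φ d) (divide (φ a) (φ b) s) = 0 := by rw [h, area_divide]; simp
    rw [area_divide] at this
    have h3 := hφ a d b had hab hbd.symm
    simpa [h3] using this
  · have : area (φ a) (φ b) (divide (φ a) (φ d) t) = 0 := by rw [← h, area_divide]; simp
    rw [area_divide] at this
    have h3 := hφ a b d hab had hbd
    simpa [h3] using this

lemma divide_flip (a b : ℝ × ℝ) (t : ℝ) : divide a b t = divide b a (1 - t) := by
  simp only [divide]; ext <;> ring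

/-- If a relative interior point of `c d` lies on the segment `a b`, then the two segments cross,
unless they coincide. -/
lemma Generic.crosses_of_interior {φ : V → ℝ × ℝ} (hφ : Generic φ) {a b c d : V} (hab : a ≠ b)
    (hcd : c ≠ d) (hne : ¬ (a = c ∧ b = d)) (hne' : ¬ (a = d ∧ b = c)) {s t : ℝ}
    (hs0 : 0 ≤ s) (hs1 : s ≤ 1) (ht0 : 0 < t) (ht1 : t < 1)
    (h : divide (φ a) (φ b) s = divide (φ c) (φ d) t) : Crosses (φ a) (φ b) (φ c) (φ d) := by
  by_cases hac : a = c
  · subst hac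
    have := hφ.eq_of_meet_share hab hcd (fun h => hne ⟨rfl, h⟩) h
    linarith [this.2]
  by_cases had : a = d
  · subst had
    rw [divide_flip (φ c)] at h
    have := hφ.eq_of_meet_share hab hac (fun h => hne' ⟨rfl, h⟩) h
    linarith [this.2]
  by_cases hbc : b = c
  · subst hbc
    rw [divide_flip (φ a)] at h
    have := hφ.eq_of_meet_share hab.symm hcd had h
    linarith [this.2]
  by_cases hbd : b = d
  · subst hbd
    rw [divide_flip (φ a), divide_flip (φ c)] at h
    have := hφ.eq_of_meet_share hab.symm (Ne.symm hcd) hac h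
    linarith [this.2]
  exact hφ.crosses_of_meet hab hcd hac had hbc hbd hs0 hs1 ht0.le ht1.le h

/-- Where a line leaves a quadrant: the first point at which one of two affine functions
vanishes. -/
lemma exists_exit {x₀ x₁ y₀ y₁ s₀ : ℝ} (hs : s₀ < 1) (hx : 0 < (1 - s₀) * x₀ + s₀ * x₁)
    (hy : 0 < (1 - s₀) * y₀ + s₀ * y₁) (h : x₁ ≤ 0 ∨ y₁ ≤ 0) :
    ∃ s, s₀ < s ∧ s ≤ 1 ∧
      (((1 - s) * x₀ + s * x₁ = 0 ∧ 0 ≤ (1 - s) * y₀ + s * y₁) ∨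
        ((1 - s) * y₀ + s * y₁ = 0 ∧ 0 < (1 - s) * x₀ + s * x₁)) := by
  -- A single affine function has its zero at `z₀ / (z₀ - z₁)` and is positive before it. What
  -- remains is to see which of the two functions vanishes first.
  have key : ∀ z₀ z₁ : ℝ, 0 < (1 - s₀) * z₀ + s₀ * z₁ → z₁ ≤ 0 →
      ∃ s, s₀ < s ∧ s ≤ 1 ∧ (1 - s) * z₀ + s * z₁ = 0 ∧
        ∀ r, r < s → 0 < (1 - r) * z₀ + r * z₁ := by
    intro z₀ z₁ hz hz1
    have hd : 0 < z₀ - z₁ := by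
      by_contra hn
      nlinarith
    have hz0 : 0 < z₀ - s₀ * (z₀ - z₁) := by linarith
    have e : z₀ / (z₀ - z₁) * (z₀ - z₁) = z₀ := div_mul_cancel₀ _ hd.ne'
    refine ⟨z₀ / (z₀ - z₁), ?_, ?_, ?_, ?_⟩
    · rw [lt_div_iff₀ hd]; linarith
    · rw [div_le_one hd]; linarith
    · linarith
    · intro r hr
      rw [lt_div_iff₀ hd] at hr; linarith
  by_cases hx1 : x₁ ≤ 0
  · obtain ⟨s, h1, h2, h3, h4⟩ := key x₀ x₁ hx hx1
    by_cases hys : 0 ≤ (1 - s) * y₀ + s * y₁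
    · exact ⟨s, h1, h2, Or.inl ⟨h3, hys⟩⟩
    · have hy1 : y₁ ≤ 0 := by
        by_contra hn
        push Not at hn hys
        nlinarith
      obtain ⟨r, g1, g2, g3, g4⟩ := key y₀ y₁ hy hy1
      refine ⟨r, g1, g2, Or.inr ⟨g3, h4 r ?_⟩⟩
      by_contra hn
      push Not at hn hys
      rcases hn.eq_or_lt with rfl | hn
      · linarith
      · linarith [g4 s hn]
  · have hy1 : y₁ ≤ 0 := h.resolve_left hx1
    obtain ⟨r, g1, g2, g3, g4⟩ := key y₀ y₁ hy hy1
    refine ⟨r, g1, g2, Or.inr ⟨g3, ?_⟩⟩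
    push Not at hx1
    by_contra hn
    nlinarith

end Configuration

/-! ### Visibility from a point among non-crossing segments. -/

section Sight

variable {V : Type*}

/-- The position on the segment `u q` at which the line `c d` cuts it. -/
noncomputable def cut (u q c d : ℝ × ℝ) : ℝ := area c d u / (area c d u - area c d q)

lemma cut_swap (u q c d : ℝ × ℝ) : cut u q d c = cut u q c d := by
  unfold cut
  rw [area_swap c d u, area_swap c d q, ← neg_div_neg_eq]
  congr 1 <;> ring

lemma cut_swap_coords (u q c d : ℝ × ℝ) : cut u.swap q.swap c.swap d.swap = cut u q c d := by
  unfold cut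
  rw [area_swap_coords, area_swap_coords, ← neg_div_neg_eq]
  congr 1 <;> ring

/-- Straight line edges `E` on the points `φ v` that do not cross each other. -/
structure Uncrossed (φ : V → ℝ × ℝ) (E : V → V → Prop) : Prop where
  symm : ∀ a b, E a b → E b a
  ne : ∀ a b, E a b → a ≠ b
  not_crosses : ∀ a b c d, E a b → E c d → ¬ Crosses (φ a) (φ b) (φ c) (φ d)

/-- The segment from `u` to `x` is not crossed by an edge of `E`. -/
def Sees (φ : V → ℝ × ℝ) (E : V → V → Prop) (u x : V) : Prop :=
  ∀ a b, E a b → ¬ Crosses (φ u) (φ x) (φ a) (φ b)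

lemma Uncrossed.swap {φ : V → ℝ × ℝ} {E : V → V → Prop} (h : Uncrossed φ E) :
    Uncrossed (fun v => (φ v).swap) E :=
  ⟨h.symm, h.ne, fun a b c d h1 h2 => by
    rw [crosses_swap_coords]; exact h.not_crosses a b c d h1 h2⟩

lemma sees_swap {φ : V → ℝ × ℝ} {E : V → V → Prop} {u x : V} :
    Sees (fun v => (φ v).swap) E u x ↔ Sees φ E u x := by
  simp only [Sees, crosses_swap_coords]

lemma Crosses.side_neg {u q c d : ℝ × ℝ} (h : Crosses u q c d) (hc : 0 < area u q c) :
    area u q d < 0 := by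
  by_contra hn
  push Not at hn
  linarith [h.1, mul_nonneg hc.le hn]

lemma Crosses.side_base {u q c d : ℝ × ℝ} (h : Crosses u q c d) (hc : 0 < area u q c) :
    0 < area d c u ∧ area d c q < 0 := by
  have hd := h.side_neg hc
  have h2 := h.swap_right.2
  have e : area d c u - area d c q = area u q c - area u q d := by unfold area; ring
  constructor
  · by_contra hn
    push Not at hn
    have : area d c q < 0 := by linarith
    linarith [mul_nonneg_of_nonpos_of_nonpos hn this.le]
  · by_contra hn
    push Not at hn
    have : 0 < area d c u := by linarith
    linarith [mul_nonneg this.le hn]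

/-- The edge `c d` is the first one met on the way from `u` to `q`. Of the vertices inside the
triangle formed by `u`, `c` and this meeting point, together with `c`, let `x` be the closest in
angle to `q`. An edge blocking `u x` would have to end in the triangle nearer to `q`, cross `c d`,
or cross `u q` before `c d` does; all three are impossible. -/
lemma exists_sees_side [Finite V] {φ : V → ℝ × ℝ} (hφ : Generic φ) {E : V → V → Prop}
    (hE : Uncrossed φ E) {u q c d : V} (huq : u ≠ q) (hcd : E c d)
    (hcr : Crosses (φ u) (φ q) (φ c) (φ d)) (hc : 0 < area (φ u) (φ q) (φ c))
    (hmin : ∀ e f, E e f → Crosses (φ u) (φ q) (φ e) (φ f) →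
      cut (φ u) (φ q) (φ c) (φ d) ≤ cut (φ u) (φ q) (φ e) (φ f)) :
    ∃ x, 0 < area (φ u) (φ q) (φ x) ∧ (x = c ∨ 0 < area (φ u) (φ x) (φ c)) ∧ Sees φ E u x := by
  classical
  have hd := hcr.side_neg hc
  obtain ⟨hLu, hLq⟩ := hcr.side_base hc
  let A : Set V := {p | 0 < area (φ u) (φ q) (φ p) ∧
    (p = c ∨ (0 < area (φ u) (φ p) (φ c) ∧ 0 < area (φ d) (φ c) (φ p)))}
  have hcA : c ∈ A := ⟨hc, Or.inl rfl⟩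
  -- The ratio is a monotone function of the angle at `u`: it grows as `p` turns from `c` towards
  -- `q`.
  obtain ⟨x, hxA, hx⟩ := Set.exists_max_image A
    (fun p => area (φ u) (φ p) (φ c) / area (φ u) (φ q) (φ p)) (Set.toFinite A) ⟨c, hcA⟩
  have hmaxx : ∀ p ∈ A, area (φ u) (φ p) (φ x) ≤ 0 := by
    intro p hp
    have h1 := hx p hp
    rw [div_le_div_iff₀ hp.1 hxA.1] at h1
    have h2 := area_plucker (φ u) (φ p) (φ x) (φ q) (φ c)
    rw [area_swap_right _ (φ q) (φ p), area_swap_right _ (φ q) (φ x)] at h2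
    by_contra hn
    push Not at hn
    linarith [mul_pos hn hc]
  obtain ⟨hαx, hxc⟩ := hxA
  have hxc' : x = c ∨ 0 < area (φ u) (φ x) (φ c) := hxc.imp id And.left
  have hβc : area (φ u) (φ c) (φ x) ≤ 0 := hmaxx c hcA
  have hLx : 0 ≤ area (φ d) (φ c) (φ x) := by
    rcases hxc with rfl | h
    · simp
    · exact h.2.le
  have hcd' := hE.ne _ _ hcd
  have hudc : 0 < area (φ u) (φ d) (φ c) := by rw [← area_rotate]; exact hLu
  have hβd : 0 < area (φ u) (φ d) (φ x) := by
    have h2 := area_plucker (φ u) (φ d) (φ q) (φ x) (φ c)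
    rw [area_swap_right _ (φ q) (φ d)] at h2
    have h3 : 0 ≤ area (φ u) (φ x) (φ c) := by
      rcases hxc' with rfl | h
      · simp
      · exact h.le
    have h4 : 0 < area (φ u) (φ d) (φ x) * area (φ u) (φ q) (φ c) := by
      nlinarith [mul_pos hudc hαx, mul_nonneg (neg_pos.2 hd).le h3]
    exact pos_of_mul_pos_left h4 hc.le
  refine ⟨x, hαx, hxc', ?_⟩
  -- The endpoint called `e` may be taken on the same side of the line `u x` as `q`.
  suffices H : ∀ e f, E e f → Crosses (φ u) (φ x) (φ e) (φ f) →
      area (φ u) (φ x) (φ e) < 0 → False by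
    intro e f hef hcr'
    by_cases he : area (φ u) (φ x) (φ e) < 0
    · exact H e f hef hcr' he
    · refine H f e (hE.symm _ _ hef) hcr'.swap_right ?_
      push Not at he
      by_contra hf
      push Not at hf
      linarith [hcr'.1, mul_nonneg he hf]
  intro e f hef hcr' he
  have hne := hE.ne _ _ hef
  have hf : 0 < area (φ u) (φ x) (φ f) := by
    by_contra hf
    push Not at hf
    linarith [hcr'.1, mul_nonneg_of_nonpos_of_nonpos he.le hf]
  have hfu : f ≠ u := by rintro rfl; simp at hf
  have heu : e ≠ u := by rintro rfl; simp at he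
  have hβe : 0 < area (φ u) (φ e) (φ x) := by rw [area_swap_right]; linarith
  have hβf : area (φ u) (φ f) (φ x) < 0 := by rw [area_swap_right]; linarith
  -- the edge is not `c d` itself
  have hne1 : ¬ (f = c ∧ e = d) := by
    rintro ⟨rfl, rfl⟩
    rcases hxc with rfl | h
    · simp at hf
    · have := hcr'.2; linarith [mul_pos hLu h.2]
  have hne2 : ¬ (f = d ∧ e = c) := by
    rintro ⟨rfl, rfl⟩
    linarith
  -- the crossing point on `u x`
  set s₀ := area (φ u) (φ x) (φ f) / (area (φ u) (φ x) (φ f) - area (φ u) (φ x) (φ e)) with hs₀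
  have hdpos : 0 < area (φ u) (φ x) (φ f) - area (φ u) (φ x) (φ e) := by linarith
  have hs₀e : s₀ * (area (φ u) (φ x) (φ f) - area (φ u) (φ x) (φ e)) = area (φ u) (φ x) (φ f) :=
    div_mul_cancel₀ _ hdpos.ne'
  have hs₀0 : 0 < s₀ := div_pos hf hdpos
  have hs₀1 : s₀ < 1 := by rw [hs₀, div_lt_one hdpos]; linarith
  have hux : u ≠ x := by rintro rfl; simp at hαx
  have hφux : φ u ≠ φ x := by intro h; rw [h] at hαx; simp at hαx
  obtain ⟨τ, hτ⟩ : ∃ τ, divide (φ f) (φ e) s₀ = divide (φ u) (φ x) τ := by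
    refine exists_eq_divide ?_ hφux
    rw [area_divide]; linarith
  have hτ01 : 0 < τ ∧ τ < 1 := by
    have h0 : (1 - τ) * area (φ e) (φ f) (φ u) + τ * area (φ e) (φ f) (φ x) = 0 := by
      rw [← area_divide, ← hτ, area_divide]; simp
    have h1 := hcr'.2
    have hA : area (φ e) (φ f) (φ u) ≠ 0 := by intro h; rw [h] at h1; simp at h1
    have hA2 : 0 < area (φ e) (φ f) (φ u) ^ 2 := by positivity
    have hB : area (φ e) (φ f) (φ x) ≠ 0 := by intro h; rw [h] at h1; simp at h1
    have hB2 : 0 < area (φ e) (φ f) (φ x) ^ 2 := by positivity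
    constructor
    · by_contra hn
      push Not at hn
      have : 0 = (1 - τ) * area (φ e) (φ f) (φ u) ^ 2
          + τ * (area (φ e) (φ f) (φ u) * area (φ e) (φ f) (φ x)) := by
        linear_combination (-area (φ e) (φ f) (φ u)) * h0
      nlinarith [mul_nonneg_of_nonpos_of_nonpos hn h1.le]
    · by_contra hn
      push Not at hn
      have : 0 = (1 - τ) * (area (φ e) (φ f) (φ u) * area (φ e) (φ f) (φ x))
          + τ * area (φ e) (φ f) (φ x) ^ 2 := by
        linear_combination (-area (φ e) (φ f) (φ x)) * h0
      nlinarith [mul_nonneg_of_nonpos_of_nonpos (sub_nonpos.2 hn) h1.le]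
  have hLt : 0 < (1 - s₀) * area (φ d) (φ c) (φ f) + s₀ * area (φ d) (φ c) (φ e) := by
    rw [← area_divide, hτ, area_divide]
    nlinarith [mul_pos (sub_pos.2 hτ01.2) hLu, mul_nonneg hτ01.1.le hLx]
  have hαt : 0 < (1 - s₀) * area (φ u) (φ q) (φ f) + s₀ * area (φ u) (φ q) (φ e) := by
    rw [← area_divide, hτ, area_divide]
    simp only [area_self_outer]
    nlinarith [mul_pos hτ01.1 hαx]
  -- Otherwise `e` would belong to `A` and be closer in angle to `q` than `x` is.
  have hout : area (φ d) (φ c) (φ e) ≤ 0 ∨ area (φ u) (φ q) (φ e) ≤ 0 := by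
    by_contra hn
    push Not at hn
    have hec : 0 < area (φ u) (φ e) (φ c) := by
      have h2 := area_plucker (φ u) (φ q) (φ e) (φ x) (φ c)
      rcases hxc' with rfl | h
      · exact hβe
      · have : 0 < area (φ u) (φ q) (φ x) * area (φ u) (φ e) (φ c) := by
          nlinarith [mul_pos hn.2 h, mul_pos hc hβe]
        exact pos_of_mul_pos_right this hαx.le
    linarith [hmaxx e ⟨hn.2, Or.inr ⟨hec, hn.1⟩⟩]
  obtain ⟨s, hs0, hs1, hs⟩ := exists_exit hs₀1 hLt hαt hout
  -- Past the crossing with `u x`, the edge stays on the side of `q`; this bounds where it can leave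
  -- the triangle.
  have hβm : 0 < area (φ u) (divide (φ f) (φ e) s) (φ x) := by
    rw [area_divide_mid, area_swap_right _ (φ f), area_swap_right _ (φ e)] at *
    nlinarith [mul_pos (sub_pos.2 hs0) hdpos]
  have hs00 : 0 ≤ s := hs₀0.le.trans hs0.le
  rw [← area_divide, ← area_divide] at hs
  rcases hs with ⟨hL, hα⟩ | ⟨hα, hL⟩
  · -- the edge leaves the triangle through `c d`
    have hφdc : φ d ≠ φ c := by intro h; rw [h] at hd; linarith
    obtain ⟨μ, hμ⟩ := exists_eq_divide hL hφdc
    have hμ0 : 0 < μ := by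
      rw [hμ, area_divide] at hα
      by_contra hn
      push Not at hn
      nlinarith [mul_pos (sub_pos.2 (hn.trans_lt one_pos)) (neg_pos.2 hd),
        mul_nonneg (neg_nonneg.2 hn) hc.le]
    have hμ1 : μ < 1 := by
      rw [hμ, area_divide_mid] at hβm
      by_contra hn
      push Not at hn
      nlinarith [mul_nonneg (sub_nonneg.2 hn) hβd.le,
        mul_nonneg (zero_le_one.trans hn) (neg_nonneg.2 hβc)]
    exact hE.not_crosses f e d c (hE.symm _ _ hef) (hE.symm _ _ hcd)
      (hφ.crosses_of_interior hne.symm hcd'.symm hne2 hne1 hs00 hs1 hμ0 hμ1 hμ)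
  · -- the edge leaves the triangle through `u q`
    have hφuq : φ u ≠ φ q := by intro h; rw [h] at hc; simp at hc
    obtain ⟨ν, hν⟩ := exists_eq_divide hα hφuq
    have hν0 : 0 < ν := by
      rw [hν, area_divide_mid] at hβm
      simp only [area_self_left, mul_zero, zero_add] at hβm
      exact pos_of_mul_pos_left hβm hαx.le
    have hdLq : 0 < area (φ d) (φ c) (φ u) - area (φ d) (φ c) (φ q) := by linarith
    have hνlt : ν < cut (φ u) (φ q) (φ d) (φ c) := by
      rw [hν, area_divide] at hL
      rw [cut, lt_div_iff₀ hdLq]; linarith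
    have hν1 : ν < 1 := by
      refine hνlt.trans ?_
      rw [cut, div_lt_one hdLq]; linarith
    have hcr2 : Crosses (φ f) (φ e) (φ u) (φ q) :=
      hφ.crosses_of_interior hne.symm huq (fun h => hfu h.1) (fun h => heu h.2) hs00 hs1 hν0 hν1 hν
    have hle := hmin f e (hE.symm _ _ hef) hcr2.symm
    have heq : ν = cut (φ u) (φ q) (φ f) (φ e) := by
      have h0 : (1 - ν) * area (φ f) (φ e) (φ u) + ν * area (φ f) (φ e) (φ q) = 0 := by
        rw [← area_divide, ← hν, area_divide]; simp
      have h1 := hcr2.1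
      have hd0 : area (φ f) (φ e) (φ u) - area (φ f) (φ e) (φ q) ≠ 0 := by
        intro h
        rw [sub_eq_zero.1 h] at h1
        nlinarith [mul_self_nonneg (area (φ f) (φ e) (φ q))]
      rw [cut, eq_div_iff hd0]; linarith
    rw [cut_swap] at hνlt
    linarith

/-- If `q` is hidden from `u` by the edges `E`, then there are an edge `c d` that hides it and
points `x` and `y` on either side of the segment from `u` to `q`, both visible from `u`, such that
as seen from `u`, the points `d`, `y`, `q`, `x`, `c` come in this order. -/
lemma exists_sees_of_not_sees [Finite V] {φ : V → ℝ × ℝ} (hφ : Generic φ) {E : V → V → Prop}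
    (hE : Uncrossed φ E) {u q : V} (huq : u ≠ q) (hq : ¬ Sees φ E u q) :
    ∃ c d x y, E c d ∧ Crosses (φ u) (φ q) (φ c) (φ d) ∧
      0 < area (φ u) (φ q) (φ c) ∧ 0 < area (φ u) (φ q) (φ x) ∧
      (x = c ∨ 0 < area (φ u) (φ x) (φ c)) ∧
      0 < area (φ u) (φ d) (φ q) ∧ 0 < area (φ u) (φ y) (φ q) ∧
      (y = d ∨ 0 < area (φ u) (φ d) (φ y)) ∧
      0 < area (φ u) (φ y) (φ x) ∧ Sees φ E u x ∧ Sees φ E u y := by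
  classical
  let H : Set (V × V) := {p | E p.1 p.2 ∧ Crosses (φ u) (φ q) (φ p.1) (φ p.2)}
  have hH : H.Nonempty := by
    simp only [Sees, not_forall, not_not] at hq
    obtain ⟨a, b, h1, h2⟩ := hq
    exact ⟨(a, b), h1, h2⟩
  obtain ⟨⟨c, d⟩, ⟨hcd, hcr⟩, hmin⟩ := Set.exists_min_image H
    (fun p => cut (φ u) (φ q) (φ p.1) (φ p.2)) (Set.toFinite H) hH
  -- `c` and `d` lie on opposite sides of `u q`, so exchanging them achieves this.
  wlog hc : 0 < area (φ u) (φ q) (φ c) generalizing c d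
  · refine this d c ?_ (hE.symm _ _ hcd) hcr.swap_right ?_
    · intro p hp
      simp only [cut_swap _ _ (φ c) (φ d)]
      exact hmin p hp
    · push Not at hc
      by_contra hn
      push Not at hn
      linarith [hcr.1, mul_nonneg_of_nonpos_of_nonpos hc hn]
  have hmin' : ∀ e f, E e f → Crosses (φ u) (φ q) (φ e) (φ f) →
      cut (φ u) (φ q) (φ c) (φ d) ≤ cut (φ u) (φ q) (φ e) (φ f) :=
    fun e f h1 h2 => hmin (e, f) ⟨h1, h2⟩
  have hd := hcr.side_neg hc
  obtain ⟨x, hx1, hx2, hx3⟩ := exists_sees_side hφ hE huq hcd hcr hc hmin'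
  -- The other side follows by reflecting the configuration and exchanging `c` and `d`.
  obtain ⟨y, hy1, hy2, hy3⟩ := exists_sees_side hφ.swap hE.swap huq (hE.symm _ _ hcd)
    (by rw [crosses_swap_coords]; exact hcr.swap_right)
    (by rw [area_swap_coords]; linarith)
    (by
      intro e f h1 h2
      rw [crosses_swap_coords] at h2
      rw [cut_swap_coords, cut_swap_coords, cut_swap]
      exact hmin' e f h1 h2)
  rw [area_swap_coords, ← area_swap_right] at hy1
  rw [area_swap_coords, ← area_swap_right] at hy2
  rw [sees_swap] at hy3
  have hdq : 0 < area (φ u) (φ d) (φ q) := by rw [area_swap_right]; linarith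
  have hdc : 0 < area (φ u) (φ d) (φ c) := by
    rw [← area_rotate]; exact (hcr.side_base hc).1
  refine ⟨c, d, x, y, hcd, hcr, hc, hx1, hx2, hdq, hy1, hy2, ?_, hx3, hy3⟩
  have hxc : 0 ≤ area (φ u) (φ x) (φ c) := by
    rcases hx2 with rfl | h
    · simp
    · exact h.le
  have hdy : 0 ≤ area (φ u) (φ d) (φ y) := by
    rcases hy2 with rfl | h
    · simp
    · exact h.le
  have hdx : 0 < area (φ u) (φ d) (φ x) := by
    have h2 := area_plucker (φ u) (φ d) (φ q) (φ x) (φ c)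
    have : 0 < area (φ u) (φ d) (φ x) * area (φ u) (φ q) (φ c) := by
      nlinarith [mul_pos hdc hx1, mul_nonneg hdq.le hxc]
    exact pos_of_mul_pos_left this hc.le
  have h2 := area_plucker (φ u) (φ d) (φ y) (φ q) (φ x)
  have : 0 < area (φ u) (φ d) (φ q) * area (φ u) (φ y) (φ x) := by
    nlinarith [mul_pos hdx hy1, mul_nonneg hdy hx1.le]
  exact pos_of_mul_pos_right this hdq.le

end Sight

/-! ### Paths as vertex lists, and rotations at the first vertex. -/

section Lists

variable {V : Type*}

/-- `b` follows `a` immediately in the list. -/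
def Consec : List V → V → V → Prop
  | [], _, _ => False
  | [_], _, _ => False
  | x :: y :: l, a, b => (a = x ∧ b = y) ∨ Consec (y :: l) a b

/-- `a` and `b` are neighbours in the list. -/
def Edge (l : List V) (a b : V) : Prop := Consec l a b ∨ Consec l b a

lemma Edge.symm {l : List V} {a b : V} (h : Edge l a b) : Edge l b a := Or.symm h

lemma consec_append (A B : List V) (x y a b : V) :
    Consec (A ++ x :: y :: B) a b ↔
      Consec (A ++ [x]) a b ∨ (a = x ∧ b = y) ∨ Consec (y :: B) a b := by
  induction A with
  | nil => simp [Consec]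
  | cons z A ih =>
    cases A with
    | nil => simp [Consec]
    | cons z' A =>
      simp only [List.cons_append, Consec] at ih ⊢
      rw [ih, or_assoc]

lemma consec_reverse (l : List V) (a b : V) : Consec l.reverse a b ↔ Consec l b a := by
  induction l with
  | nil => simp [Consec]
  | cons x l ih =>
    cases l with
    | nil => simp [Consec]
    | cons y l =>
      rw [List.reverse_cons, List.reverse_cons, List.append_assoc] at *
      simp only [List.cons_append, List.nil_append]
      rw [consec_append, ih]
      simp only [Consec, or_false]
      tauto

lemma edge_reverse (l : List V) (a b : V) : Edge l.reverse a b ↔ Edge l a b := by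
  simp only [Edge, consec_reverse]; tauto

lemma Consec.mem_left {l : List V} {a b : V} (h : Consec l a b) : a ∈ l := by
  induction l with
  | nil => exact h.elim
  | cons x l ih =>
    cases l with
    | nil => exact h.elim
    | cons y l =>
      rcases h with h | h
      · simp [h.1]
      · exact List.mem_cons_of_mem _ (ih h)

lemma Consec.mem_right {x : V} {l : List V} {a b : V} (h : Consec (x :: l) a b) : b ∈ l := by
  induction l generalizing x with
  | nil => exact h.elim
  | cons y l ih =>
    rcases h with h | h
    · simp [h.2]
    · exact List.mem_cons_of_mem _ (ih h)

lemma Consec.right_unique {l : List V} (hl : l.Nodup) {a b c : V} (h1 : Consec l a b)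
    (h2 : Consec l a c) : b = c := by
  induction l with
  | nil => exact h1.elim
  | cons x l ih =>
    cases l with
    | nil => exact h1.elim
    | cons y l =>
      have hx := (List.nodup_cons.1 hl).1
      rcases h1 with h1 | h1 <;> rcases h2 with h2 | h2
      · rw [h1.2, h2.2]
      · exact absurd h2.mem_left (h1.1 ▸ hx)
      · exact absurd h1.mem_left (h2.1 ▸ hx)
      · exact ih (List.nodup_cons.1 hl).2 h1 h2

lemma Consec.left_unique {l : List V} (hl : l.Nodup) {a b c : V} (h1 : Consec l a c)
    (h2 : Consec l b c) : a = b := by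
  rw [← consec_reverse] at h1 h2
  exact h1.right_unique (List.nodup_reverse.2 hl) h2

lemma Consec.asymm {l : List V} (hl : l.Nodup) {a b : V} (h1 : Consec l a b) :
    ¬ Consec l b a := by
  intro h2
  induction l with
  | nil => exact h1.elim
  | cons x l ih =>
    cases l with
    | nil => exact h1.elim
    | cons y l =>
      have hx := (List.nodup_cons.1 hl).1
      rcases h1 with h1 | h1 <;> rcases h2 with h2 | h2
      · exact hx (by rw [← h1.1, h2.2]; simp)
      · exact hx (h1.1 ▸ List.mem_cons_of_mem _ h2.mem_right)
      · exact hx (h2.1 ▸ List.mem_cons_of_mem _ h1.mem_right)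
      · exact ih (List.nodup_cons.1 hl).2 h1 h2

lemma Consec.ne {l : List V} (hl : l.Nodup) {a b : V} (h : Consec l a b) : a ≠ b := by
  rintro rfl
  exact h.asymm hl h

lemma Edge.ne {l : List V} (hl : l.Nodup) {a b : V} (h : Edge l a b) : a ≠ b :=
  h.elim (fun h => h.ne hl) (fun h => (h.ne hl).symm)

lemma Edge.eq_of_head {u x b : V} {B : List V} (hl : (u :: x :: B).Nodup)
    (h : Edge (u :: x :: B) u b) : b = x := by
  rcases h with h | h
  · exact h.right_unique hl (Or.inl ⟨rfl, rfl⟩)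
  · exact absurd h.mem_right (List.nodup_cons.1 hl).1

lemma Edge.of_second {u x b : V} {B : List V} (hl : (u :: x :: B).Nodup)
    (h : Edge (u :: x :: B) x b) (hb : b ≠ u) : ∃ B', B = b :: B' := by
  rcases h with h | h
  · cases B with
    | nil =>
      rcases h with h | h
      · simp [h.1] at hl
      · exact h.elim
    | cons z B =>
      rw [h.right_unique hl (c := z) (Or.inr (Or.inl ⟨rfl, rfl⟩))]
      exact ⟨B, rfl⟩
  · exact absurd (h.left_unique hl (Or.inl ⟨rfl, rfl⟩)) hb

/-- `l'` arises from the path `l` with first vertex `u` by adding the edge `u y` and removing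
the edge `x y`; it starts at `x`. -/
def Rot (l : List V) (u y x : V) (l' : List V) : Prop :=
  ∃ A B, l = u :: (A ++ x :: y :: B) ∧ l' = x :: (A.reverse ++ u :: y :: B)

variable {l l₁ l₂ q₁ q₂ : List V} {u x y z w : V}

lemma Rot.symm (h : Rot l u y x l₁) : Rot l₁ x y u l := by
  obtain ⟨A, B, rfl, rfl⟩ := h
  exact ⟨A.reverse, B, rfl, by simp⟩

lemma Rot.perm (h : Rot l u y x l₁) : l₁.Perm l := by
  obtain ⟨A, B, rfl, rfl⟩ := h
  have h1 : x :: (A.reverse ++ u :: y :: B) = (u :: (A ++ [x])).reverse ++ y :: B := by simp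
  have h2 : u :: (A ++ x :: y :: B) = (u :: (A ++ [x])) ++ y :: B := by simp
  rw [h1, h2]
  exact (List.reverse_perm _).append_right _

lemma Rot.getLast? (h : Rot l u y x l₁) : l₁.getLast? = l.getLast? := by
  obtain ⟨A, B, rfl, rfl⟩ := h
  have h1 : x :: (A.reverse ++ u :: y :: B) = (x :: (A.reverse ++ [u])) ++ y :: B := by simp
  have h2 : u :: (A ++ x :: y :: B) = (u :: (A ++ [x])) ++ y :: B := by simp
  rw [h1, h2, List.getLast?_append_of_ne_nil _ (by simp),
    List.getLast?_append_of_ne_nil _ (by simp)]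

lemma Rot.consec (h : Rot l u y x l₁) : Consec l x y := by
  obtain ⟨A, B, rfl, rfl⟩ := h
  rw [← List.cons_append, consec_append]
  exact Or.inr (Or.inl ⟨rfl, rfl⟩)

/-- Reversing the initial segment that ends in `x` keeps its edges, so `u y` is the only new one.
The converse direction comes from `Rot.symm`. -/
lemma Rot.edge (h : Rot l u y x l₁) {a b : V} (hab : Edge l₁ a b) :
    Edge l a b ∨ (a = u ∧ b = y) ∨ (a = y ∧ b = u) := by
  obtain ⟨A, B, rfl, rfl⟩ := h
  have hr : ∀ a b, Consec (x :: A.reverse ++ [u]) a b ↔ Consec (u :: A ++ [x]) b a := by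
    intro a b
    rw [← consec_reverse]; simp
  simp only [Edge, ← List.cons_append, consec_append, hr] at hab ⊢
  tauto

lemma Rot.ne (h : Rot l u y x l₁) (hl : l.Nodup) : u ≠ y ∧ u ≠ x := by
  obtain ⟨A, B, rfl, rfl⟩ := h
  have := (List.nodup_cons.1 hl).1
  constructor <;> rintro rfl <;> simp at this

lemma Rot.not_edge (h : Rot l u y x l₁) (hl : l.Nodup) : ¬ Edge l u y := by
  have hne := h.ne hl
  have hc := h.consec
  rintro (h1 | h1)
  · exact hne.2 (h1.left_unique hl hc)
  · obtain ⟨A, B, rfl, rfl⟩ := h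
    exact (List.nodup_cons.1 hl).1 h1.mem_right

lemma Rot.nodup (h : Rot l u y x l₁) (hl : l.Nodup) : l₁.Nodup := h.perm.nodup_iff.2 hl

lemma Rot.list_ne (h : Rot l u y x l₁) (hl : l.Nodup) : l₁ ≠ l := by
  rintro rfl
  exact h.not_edge hl (Or.inl h.symm.consec)

/-- Rotating on from a rotation keeps the new edge, unless it goes back. -/
lemma Rot.edge_of_rot (h : Rot l u y x l₁) (hl : l.Nodup) (h1 : Rot l₁ x z w q₁) (hz : z ≠ y) :
    Edge q₁ u y := by
  have hn := h.nodup hl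
  rcases h1.symm.edge (Or.inl h.symm.consec) with h2 | h2 | h2
  · exact h2
  · exact absurd h2.2.symm hz
  · obtain ⟨rfl, rfl⟩ := h2
    exact absurd h1.consec (h.symm.consec.asymm hn)

lemma Rot.not_edge_of_rot {x₂ y₂ : V} (h : Rot l u y x l₁) (hl : l.Nodup)
    (h2 : Rot l u y₂ x₂ l₂) (hy : y₂ ≠ y) : ¬ Edge l₂ u y := by
  intro h3
  rcases h2.edge h3 with h3 | h3 | h3
  · exact h.not_edge hl h3
  · exact hy h3.2.symm
  · exact (h2.ne hl).1 h3.1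

lemma Rot.ne_of_rot {x₂ y₂ : V} (h : Rot l u y x l₁) (hl : l.Nodup)
    (h2 : Rot l u y₂ x₂ l₂) (hy : y₂ ≠ y) : l₁ ≠ l₂ := by
  rintro rfl
  exact h.not_edge_of_rot hl h2 hy (Or.inl h.symm.consec)

/-- If the results agreed, the edge `u y₂`, kept by the second route, would have to be the edge
added in the second step of the first route, at its end `x₁`. As `x₁ ≠ u`, this gives `x₁ = y₂`, and
likewise `x₂ = y₁`. Then `x₁` and `x₂` would each immediately precede the other in `l`. -/
lemma Rot.two_step_ne {x₁ x₂ y₁ y₂ z₁ z₂ w₁ w₂ : V} (hl : l.Nodup) (h₁ : Rot l u y₁ x₁ l₁)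
    (h₂ : Rot l u y₂ x₂ l₂) (hy : y₁ ≠ y₂) (g₁ : Rot l₁ x₁ z₁ w₁ q₁) (g₂ : Rot l₂ x₂ z₂ w₂ q₂)
    (hz₁ : z₁ ≠ y₁) (hz₂ : z₂ ≠ y₂) : q₁ ≠ q₂ := by
  rintro rfl
  have key : ∀ {x₁ x₂ y₁ y₂ z₁ z₂ w₁ w₂ : V} {l₁ l₂ : List V}, Rot l u y₁ x₁ l₁ →
      Rot l u y₂ x₂ l₂ → y₁ ≠ y₂ → Rot l₁ x₁ z₁ w₁ q₁ → Rot l₂ x₂ z₂ w₂ q₁ → z₁ ≠ y₁ → z₂ ≠ y₂ →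
      x₁ = y₂ := by
    intro x₁ x₂ y₁ y₂ z₁ z₂ w₁ w₂ l₁ l₂ h₁ h₂ hy g₁ g₂ hz₁ hz₂
    rcases g₁.edge (h₂.edge_of_rot hl g₂ hz₂) with h | h | h
    · exact absurd h (h₂.not_edge_of_rot hl h₁ hy)
    · exact absurd h.1 (h₁.ne hl).2
    · exact h.2.symm
  have e1 := key h₁ h₂ hy g₁ g₂ hz₁ hz₂
  have e2 := key h₂ h₁ hy.symm g₂ g₁ hz₂ hz₁
  subst e1 e2
  exact h₁.consec.asymm hl h₂.consec

/-- The list is a spanning path without crossings. -/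
structure PlaneList (φ : V → ℝ × ℝ) (l : List V) : Prop where
  nodup : l.Nodup
  mem : ∀ v, v ∈ l
  not_crosses : ∀ a b c d, Edge l a b → Edge l c d → ¬ Crosses (φ a) (φ b) (φ c) (φ d)

lemma PlaneList.uncrossed {φ : V → ℝ × ℝ} (h : PlaneList φ l) : Uncrossed φ (Edge l) :=
  ⟨fun _ _ h => h.symm, fun _ _ h1 => h1.ne h.nodup, h.not_crosses⟩

lemma PlaneList.swap {φ : V → ℝ × ℝ} (h : PlaneList φ l) :
    PlaneList (fun v => (φ v).swap) l :=
  ⟨h.nodup, h.mem, h.uncrossed.swap.not_crosses⟩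

lemma PlaneList.reverse {φ : V → ℝ × ℝ} (h : PlaneList φ l) : PlaneList φ l.reverse :=
  ⟨List.nodup_reverse.2 h.nodup, fun v => List.mem_reverse.2 (h.mem v), fun a b c d h1 h2 =>
    h.not_crosses a b c d ((edge_reverse _ _ _).1 h1) ((edge_reverse _ _ _).1 h2)⟩

lemma PlaneList.rot {φ : V → ℝ × ℝ} (h : PlaneList φ l) (hr : Rot l u y x l₁)
    (hs : Sees φ (Edge l) u y) : PlaneList φ l₁ := by
  refine ⟨hr.nodup h.nodup, fun v => hr.perm.mem_iff.2 (h.mem v), fun a b c d h1 h2 => ?_⟩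
  have hs' : ∀ a b, Edge l a b → ¬ Crosses (φ y) (φ u) (φ a) (φ b) :=
    fun a b hab hc => hs a b hab hc.swap_left
  have hself : ¬ Crosses (φ u) (φ y) (φ u) (φ y) := not_crosses_share _ _ _
  rcases hr.edge h1 with h1 | ⟨rfl, rfl⟩ | ⟨rfl, rfl⟩ <;>
    rcases hr.edge h2 with h2 | ⟨rfl, rfl⟩ | ⟨rfl, rfl⟩
  · exact h.not_crosses a b c d h1 h2
  · exact fun hc => hs _ _ h1 hc.symm
  · exact fun hc => hs' _ _ h1 hc.symm
  · exact hs _ _ h2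
  · exact hself
  · exact fun hc => hself hc.swap_right
  · exact hs' _ _ h2
  · exact fun hc => hself hc.swap_left
  · exact fun hc => hself hc.swap_left.swap_right

/-- The first vertex `u` of the path `l` can be joined to `y`, which is not its neighbour. -/
def Avail (φ : V → ℝ × ℝ) (l : List V) (u y : V) : Prop :=
  ∃ x B, l = u :: x :: B ∧ y ≠ u ∧ y ≠ x ∧ Sees φ (Edge l) u y

lemma Avail.swap {φ : V → ℝ × ℝ} (h : Avail φ l u y) : Avail (fun v => (φ v).swap) l u y := by
  simpa only [Avail, sees_swap] using h

lemma avail_swap_iff {φ : V → ℝ × ℝ} :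
    Avail (fun v => (φ v).swap) l u y ↔ Avail φ l u y := by
  simp only [Avail, sees_swap]

lemma avail_cons_iff {φ : V → ℝ × ℝ} {B : List V} :
    Avail φ (u :: x :: B) u y ↔ y ≠ u ∧ y ≠ x ∧ Sees φ (Edge (u :: x :: B)) u y := by
  constructor
  · rintro ⟨x', B', h, h1, h2, h3⟩
    simp only [List.cons.injEq, true_and] at h
    obtain ⟨rfl, rfl⟩ := h
    exact ⟨h1, h2, h3⟩
  · exact fun h => ⟨x, B, rfl, h⟩

/-- The deleted edge `x y` crosses no old edge and shares `y` with the new one, so the way back is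
always open. A path has a further rotation exactly when another vertex is available. -/
lemma Rot.avail {φ : V → ℝ × ℝ} (h : PlaneList φ l) (hr : Rot l u y x l₁) : Avail φ l₁ x y := by
  have hn := hr.nodup h.nodup
  have hs : Sees φ (Edge l₁) x y := by
    intro a b hab
    rcases hr.edge hab with h1 | ⟨rfl, rfl⟩ | ⟨rfl, rfl⟩
    · exact h.not_crosses x y a b (Or.inl hr.consec) h1
    · exact fun hc => not_crosses_share _ _ _ hc.swap_left.swap_right
    · exact fun hc => not_crosses_share _ _ _ hc.swap_left
  have hne := hr.symm.ne hn
  have hned := hr.symm.not_edge hn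
  obtain ⟨A, B, rfl, rfl⟩ := hr
  rcases hA : A.reverse with _ | ⟨a, A'⟩
  · rw [hA] at hs hned
    exact ⟨u, y :: B, rfl, hne.1.symm, fun h => hned (h ▸ Or.inl (Or.inl ⟨rfl, rfl⟩)), hs⟩
  · rw [hA] at hs hned
    exact ⟨a, A' ++ u :: y :: B, rfl, hne.1.symm,
      fun h => hned (h ▸ Or.inl (Or.inl ⟨rfl, rfl⟩)), hs⟩

lemma Avail.exists_rot {φ : V → ℝ × ℝ} (h : PlaneList φ l) (ha : Avail φ l u y) :
    ∃ x l₁, Rot l u y x l₁ ∧ PlaneList φ l₁ ∧ Avail φ l₁ x y := by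
  obtain ⟨x, B, rfl, h1, h2, h3⟩ := ha
  have hy := h.mem y
  simp only [List.mem_cons, h1, h2, false_or] at hy
  obtain ⟨A, C, rfl⟩ := List.append_of_mem hy
  -- `w` is the predecessor of `y`, possibly `x` itself; it becomes the new end.
  obtain ⟨A', w, hA⟩ : ∃ A' w, x :: A = A' ++ [w] := by
    rcases List.eq_nil_or_concat (x :: A) with h | ⟨A', w, h⟩
    · simp at h
    · exact ⟨A', w, by simpa using h⟩
  have hr : Rot (u :: x :: (A ++ y :: C)) u y w (w :: (A'.reverse ++ u :: y :: C)) := by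
    refine ⟨A', C, ?_, rfl⟩
    rw [← List.cons_append, hA]; simp
  exact ⟨w, _, hr, h.rot hr h3, hr.avail h⟩

end Lists

/-! ### What an end with few available vertices forces. -/

section Endpoint

variable {V : Type*} [Fintype V] {φ : V → ℝ × ℝ} {l : List V} {u x y w : V} {B : List V}

/-- Crossing segments are the diagonals of a convex quadrilateral, and `a c` is one of its sides. -/
lemma Crosses.same_side {a b c d : ℝ × ℝ} (h : Crosses a b c d) :
    0 < area a c b * area a c d := by
  obtain ⟨h1, h2⟩ := h
  have e1 : area a c b = -area a b c := area_swap_right _ _ _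
  have e2 : area a c d = area c d a := (area_rotate _ _ _).symm
  have e : area a b c - area a b d + area c d a - area c d b = 0 := by unfold area; ring
  rw [e1, e2]
  rcases lt_or_ge 0 (area a b c) with hp | hp
  · have hq : area a b d < 0 := by
      by_contra hn
      push Not at hn
      linarith [mul_nonneg hp.le hn]
    have hr : area c d a < 0 := by
      by_contra hn
      push Not at hn
      nlinarith
    nlinarith [mul_pos_of_neg_of_neg hr (neg_neg_of_pos hp)]
  · have hq : 0 < area a b d := by
      by_contra hn
      push Not at hn
      linarith [mul_nonneg_of_nonpos_of_nonpos hp hn]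
    have hp' : area a b c < 0 := by
      by_contra hn
      push Not at hn
      have : area a b c = 0 := le_antisymm hp hn
      rw [this] at h1; simp at h1
    have hr : 0 < area c d a := by
      by_contra hn
      push Not at hn
      nlinarith
    nlinarith [mul_pos hr (neg_pos.2 hp')]

lemma exists_notMem_of_card_lt [DecidableEq V] (F : Finset V) (h : F.card < Fintype.card V) :
    ∃ q, q ∉ F := by
  by_contra hn
  push Not at hn
  rw [Finset.eq_univ_iff_forall.2 hn, Finset.card_univ] at h
  exact h.false

lemma PlaneList.length_eq (h : PlaneList φ l) : l.length = Fintype.card V := by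
  classical
  rw [← List.toFinset_card_of_nodup h.nodup, ← Finset.card_univ]
  congr 1
  ext v; simp [h.mem]

lemma PlaneList.exists_cons_cons (h : PlaneList φ l) (hV : 2 ≤ Fintype.card V) :
    ∃ u x B, l = u :: x :: B := by
  rw [← h.length_eq] at hV
  match l, hV with
  | u :: x :: B, _ => exact ⟨u, x, B, rfl⟩

/-- The end of a plane spanning path sees a vertex other than its neighbour. -/
lemma PlaneList.exists_avail (hφ : Generic φ) (h : PlaneList φ (u :: x :: B))
    (hV : 3 ≤ Fintype.card V) : ∃ y, Avail φ (u :: x :: B) u y := by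
  classical
  obtain ⟨q, hq⟩ := exists_notMem_of_card_lt {u, x} (lt_of_le_of_lt Finset.card_le_two hV)
  simp only [Finset.mem_insert, Finset.mem_singleton, not_or] at hq
  by_cases hs : Sees φ (Edge (u :: x :: B)) u q
  · exact ⟨q, avail_cons_iff.2 ⟨hq.1, hq.2, hs⟩⟩
  obtain ⟨c, d, y, z, -, -, -, hy, -, -, hz, -, hzy, hys, hzs⟩ :=
    exists_sees_of_not_sees hφ h.uncrossed (Ne.symm hq.1) hs
  have hyu : y ≠ u := by rintro rfl; simp at hy
  have hzu : z ≠ u := by rintro rfl; simp at hz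
  by_cases hyx : y = x
  · refine ⟨z, avail_cons_iff.2 ⟨hzu, ?_, hzs⟩⟩
    rintro rfl
    rw [hyx] at hzy; simp at hzy
  · exact ⟨y, avail_cons_iff.2 ⟨hyu, hyx, hys⟩⟩

/-- If only two points are visible from `u`, all the others are hidden by the edge joining
these two. -/
lemma crosses_of_sees_two (hφ : Generic φ) {E : V → V → Prop} (hE : Uncrossed φ E) {p r : V}
    (hrp : 0 < area (φ u) (φ r) (φ p)) (hs : ∀ z, z ≠ u → Sees φ E u z → z = p ∨ z = r) {q : V}
    (hqu : q ≠ u) (hqp : q ≠ p) (hqr : q ≠ r) :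
    E p r ∧ Crosses (φ u) (φ q) (φ p) (φ r) := by
  have key : ∀ q, q ≠ u → q ≠ p → q ≠ r → ∃ c d, E c d ∧ Crosses (φ u) (φ q) (φ c) (φ d) ∧
      0 < area (φ u) (φ q) (φ c) ∧ 0 < area (φ u) (φ d) (φ q) ∧
      (p = c ∨ 0 < area (φ u) (φ p) (φ c)) ∧ (r = d ∨ 0 < area (φ u) (φ d) (φ r)) ∧
      0 < area (φ u) (φ q) (φ p) ∧ 0 < area (φ u) (φ r) (φ q) := by
    intro q hqu hqp hqr
    have hns : ¬ Sees φ E u q := fun h => (hs q hqu h).elim hqp hqr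
    obtain ⟨c, d, y, z, hcd, hcr, hc, hy, hyc, hd, hz, hzd, hzy, hys, hzs⟩ :=
      exists_sees_of_not_sees hφ hE hqu.symm hns
    have hyu : y ≠ u := by rintro rfl; simp at hy
    have hzu : z ≠ u := by rintro rfl; simp at hz
    rcases hs y hyu hys with rfl | rfl <;> rcases hs z hzu hzs with rfl | rfl
    · simp at hzy
    · exact ⟨c, d, hcd, hcr, hc, hd, hyc, hzd, hy, hz⟩
    · rw [area_swap_right] at hzy; linarith
    · simp at hzy
  obtain ⟨c, d, hcd, hcr, hc, hd, hpc, hrd, hp, hr⟩ := key q hqu hqp hqr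
  have hcu : c ≠ u := by rintro rfl; simp at hc
  have hdu : d ≠ u := by rintro rfl; simp at hd
  -- Seen from `u`, every third point lies strictly between `r` and `p`, whereas `c` is `p` or lies
  -- beyond it. The same reasoning gives `d = r`.
  have hcp : c = p := by
    by_contra hn
    have h1 := hpc.resolve_left (Ne.symm hn)
    have hcr' : c ≠ r := by
      rintro rfl
      rw [area_swap_right] at hrp; linarith
    obtain ⟨-, -, -, -, -, -, -, -, h2, -⟩ := key c hcu hn hcr'
    rw [area_swap_right] at h2; linarith
  have hdr : d = r := by
    by_contra hn
    have h1 := hrd.resolve_left (Ne.symm hn)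
    have hdp : d ≠ p := by
      rintro rfl
      rw [area_swap_right] at hrp; linarith
    obtain ⟨-, -, -, -, -, -, -, -, -, h2⟩ := key d hdu hdp hn
    rw [area_swap_right] at h2; linarith
  subst hcp hdr
  exact ⟨hcd, hcr⟩

/-- If the end `u` of a path has just one available point, then this is the third vertex, and
the edge between the second and the third vertex hides everything else. -/
lemma PlaneList.third_of_unique_avail (hφ : Generic φ) (h : PlaneList φ (u :: x :: B))
    (hV : 4 ≤ Fintype.card V) (ha : Avail φ (u :: x :: B) u y)
    (huniq : ∀ z, Avail φ (u :: x :: B) u z → z = y) :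
    (∃ B', B = y :: B') ∧
      ∀ q, q ≠ u → q ≠ x → q ≠ y → Crosses (φ u) (φ q) (φ x) (φ y) := by
  classical
  obtain ⟨hyu, hyx, -⟩ := avail_cons_iff.1 ha
  have hux : u ≠ x := Edge.ne h.nodup (Or.inl (Or.inl ⟨rfl, rfl⟩))
  have hs : ∀ z, z ≠ u → Sees φ (Edge (u :: x :: B)) u z → z = x ∨ z = y := by
    intro z hz hzs
    by_cases hzx : z = x
    · exact Or.inl hzx
    · exact Or.inr (huniq z (avail_cons_iff.2 ⟨hz, hzx, hzs⟩))
  have key : ∀ q, q ≠ u → q ≠ x → q ≠ y →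
      Edge (u :: x :: B) x y ∧ Crosses (φ u) (φ q) (φ x) (φ y) := by
    intro q h1 h2 h3
    rcases lt_or_gt_of_ne (hφ u x y hux hyu.symm hyx.symm) with hd | hd
    · exact crosses_of_sees_two hφ h.uncrossed (by rw [area_swap_right]; linarith) hs h1 h2 h3
    · have := crosses_of_sees_two hφ h.uncrossed hd (fun z a b => (hs z a b).symm) h1 h3 h2
      exact ⟨this.1.symm, this.2.swap_right⟩
  refine ⟨?_, fun q h1 h2 h3 => (key q h1 h2 h3).2⟩
  obtain ⟨q, hq⟩ := exists_notMem_of_card_lt {u, x, y} (lt_of_le_of_lt Finset.card_le_three hV)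
  simp only [Finset.mem_insert, Finset.mem_singleton, not_or] at hq
  exact (key q hq.1 hq.2.1 hq.2.2).1.of_second h.nodup hyu

/-- Swapping the first two vertices of a path whose end has a single available point gives a
path whose end has another available point. -/
lemma PlaneList.exists_avail_of_hidden (hφ : Generic φ) (h : PlaneList φ (x :: u :: y :: B))
    (hV : 4 ≤ Fintype.card V) (hsee : Sees φ (Edge (x :: u :: y :: B)) x y)
    (hcr : ∀ q, q ≠ u → q ≠ x → q ≠ y → Crosses (φ u) (φ q) (φ x) (φ y)) :
    ∃ w, Avail φ (x :: u :: y :: B) x w ∧ w ≠ y := by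
  classical
  obtain ⟨q, hq⟩ := exists_notMem_of_card_lt {u, x, y} (lt_of_le_of_lt Finset.card_le_three hV)
  simp only [Finset.mem_insert, Finset.mem_singleton, not_or] at hq
  obtain ⟨hqu, hqx, hqy⟩ := hq
  by_cases hs : Sees φ (Edge (x :: u :: y :: B)) x q
  · exact ⟨q, avail_cons_iff.2 ⟨hqx, hqu, hs⟩, hqy⟩
  obtain ⟨c, d, p, r, -, -, -, hp, -, -, hr, -, hrp, hps, hrs⟩ :=
    exists_sees_of_not_sees hφ h.uncrossed (Ne.symm hqx) hs
  have hpx : p ≠ x := by rintro rfl; simp at hp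
  have hrx : r ≠ x := by rintro rfl; simp at hr
  -- `q` and `u` are on opposite sides of the line `x y`, so `q` is not in the angle at `x` between
  -- `u` and `y`. Hence `p` and `r` cannot both be among `u` and `y`.
  have hopp := (hcr q hqu hqx hqy).2
  by_contra hn
  push Not at hn
  have hp' : p = u ∨ p = y := by
    by_contra hpn
    push Not at hpn
    exact hpn.2 (hn p (avail_cons_iff.2 ⟨hpx, hpn.1, hps⟩))
  have hr' : r = u ∨ r = y := by
    by_contra hrn
    push Not at hrn
    exact hrn.2 (hn r (avail_cons_iff.2 ⟨hrx, hrn.1, hrs⟩))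
  rcases hp' with rfl | rfl <;> rcases hr' with rfl | rfl
  · simp at hrp
  · linarith [mul_pos hrp hr]
  · rw [area_swap_right] at hp hrp
    nlinarith
  · simp at hrp

/-- In the situation of `exists_avail_of_hidden`, if there is only one other available point
`w`, then it is the fourth vertex, and the edge from `y` to `w` hides everything else. -/
lemma PlaneList.fourth_of_hidden (hφ : Generic φ) (h : PlaneList φ (x :: u :: y :: B))
    (hV : 5 ≤ Fintype.card V)
    (hcr : ∀ q, q ≠ u → q ≠ x → q ≠ y → Crosses (φ u) (φ q) (φ x) (φ y))
    (hw : Avail φ (x :: u :: y :: B) x w) (hwy : w ≠ y)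
    (hav : ∀ z, Avail φ (x :: u :: y :: B) x z → z = y ∨ z = w) :
    (∃ B', B = w :: B') ∧
      ∀ q, q ≠ u → q ≠ x → q ≠ y → q ≠ w → Crosses (φ x) (φ q) (φ w) (φ y) := by
  classical
  have hxu : x ≠ u := Edge.ne h.nodup (Or.inl (Or.inl ⟨rfl, rfl⟩))
  have huy : u ≠ y := Edge.ne h.nodup (Or.inl (Or.inr (Or.inl ⟨rfl, rfl⟩)))
  have hxy : x ≠ y := by
    rintro rfl
    exact (List.nodup_cons.1 h.nodup).1 (by simp)
  wlog hor : 0 < area (φ x) (φ u) (φ y) generalizing φ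
  · have hor' := lt_of_le_of_ne (not_lt.1 hor) (hφ x u y hxu hxy huy)
    have := this hφ.swap h.swap (fun q a b c => (crosses_swap_coords _ _ _ _).2 (hcr q a b c))
      hw.swap (fun z hz => hav z (avail_swap_iff.1 hz))
      (by rw [area_swap_coords]; linarith)
    exact ⟨this.1, fun q a b c d => (crosses_swap_coords _ _ _ _).1 (this.2 q a b c d)⟩
  obtain ⟨hwx, hwu, hws⟩ := avail_cons_iff.1 hw
  -- Seen from `x`, all other points come after both `u` and `y` in the chosen orientation. The
  -- visible point beyond a hidden `q` can then only be `w`, so `w` is the last of all.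
  have hside : ∀ q, q ≠ u → q ≠ x → q ≠ y →
      0 < area (φ x) (φ u) (φ q) ∧ 0 < area (φ x) (φ y) (φ q) := by
    intro q h1 h2 h3
    have hc := hcr q h1 h2 h3
    constructor
    · have := hc.same_side
      rw [area_swap (φ x) (φ u), area_swap (φ x) (φ u)] at this
      nlinarith
    · have h4 := hc.2
      rw [area_swap_right (φ x) (φ u) (φ y)] at h4
      nlinarith
  have hseen : ∀ z, z ≠ x → Sees φ (Edge (x :: u :: y :: B)) x z → z = u ∨ z = y ∨ z = w := by
    intro z hz hzs
    by_cases hzu : z = u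
    · exact Or.inl hzu
    · exact Or.inr (hav z (avail_cons_iff.2 ⟨hz, hzu, hzs⟩))
  have key : ∀ q, q ≠ u → q ≠ x → q ≠ y → q ≠ w → ∃ c d, Edge (x :: u :: y :: B) c d ∧
      Crosses (φ x) (φ q) (φ c) (φ d) ∧ 0 < area (φ x) (φ q) (φ c) ∧
      (w = c ∨ 0 < area (φ x) (φ w) (φ c)) ∧ 0 < area (φ x) (φ d) (φ q) ∧
      (d = u ∨ d = y ∨ 0 < area (φ x) (φ d) (φ u) ∨ 0 < area (φ x) (φ d) (φ y)) ∧
      0 < area (φ x) (φ q) (φ w) := by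
    intro q h1 h2 h3 h4
    have hns : ¬ Sees φ (Edge (x :: u :: y :: B)) x q := by
      intro hs
      rcases hseen q h2 hs with h | h | h
      · exact h1 h
      · exact h3 h
      · exact h4 h
    obtain ⟨c, d, p, r, hcd, hcr', hc, hp, hpc, hd, hr, hrd, hrp, hps, hrs⟩ :=
      exists_sees_of_not_sees hφ h.uncrossed (Ne.symm h2) hns
    have hpx : p ≠ x := by rintro rfl; simp at hp
    have hrx : r ≠ x := by rintro rfl; simp at hr
    obtain ⟨hq1, hq2⟩ := hside q h1 h2 h3
    have hpw : p = w := by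
      rcases hseen p hpx hps with rfl | rfl | rfl
      · rw [area_swap_right] at hp; linarith
      · rw [area_swap_right] at hp; linarith
      · rfl
    subst hpw
    refine ⟨c, d, hcd, hcr', hc, hpc, hd, ?_, hp⟩
    rcases hseen r hrx hrs with rfl | rfl | rfl
    · rcases hrd with rfl | hrd
      · exact Or.inl rfl
      · exact Or.inr (Or.inr (Or.inl hrd))
    · rcases hrd with rfl | hrd
      · exact Or.inr (Or.inl rfl)
      · exact Or.inr (Or.inr (Or.inr hrd))
    · simp at hrp
  have main : ∀ q, q ≠ u → q ≠ x → q ≠ y → q ≠ w →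
      Edge (x :: u :: y :: B) w y ∧ Crosses (φ x) (φ q) (φ w) (φ y) := by
    intro q h1 h2 h3 h4
    obtain ⟨c, d, hcd, hcr', hc, hwc, hd, hdd, hqw⟩ := key q h1 h2 h3 h4
    obtain ⟨hq1, hq2⟩ := hside q h1 h2 h3
    have hcw : c = w := by
      by_contra hn
      have hcx : c ≠ x := by rintro rfl; simp at hc
      have hcu : c ≠ u := by
        rintro rfl
        rw [area_swap_right] at hc; linarith
      have hcy : c ≠ y := by
        rintro rfl
        rw [area_swap_right] at hc; linarith
      obtain ⟨-, -, -, -, -, -, -, -, h5⟩ := key c hcu hcx hcy hn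
      have h6 := hwc.resolve_left (Ne.symm hn)
      rw [area_swap_right] at h6; linarith
    -- The neighbours of `u` on the path are `x` and `y`, and `w` is neither.
    have hdu : d ≠ u := by
      rintro rfl
      subst hcw
      rcases hcd with h5 | h5
      · exact hwx (h5.left_unique h.nodup (Or.inl ⟨rfl, rfl⟩))
      · exact hwy (h5.right_unique h.nodup (Or.inr (Or.inl ⟨rfl, rfl⟩)))
    have hdy : d = y := by
      by_contra hn
      have hdx : d ≠ x := by rintro rfl; simp at hd
      obtain ⟨h5, h6⟩ := hside d hdu hdx hn
      rcases hdd with h7 | h7 | h7 | h7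
      · exact hdu h7
      · exact hn h7
      · rw [area_swap_right] at h7; linarith
      · rw [area_swap_right] at h7; linarith
    subst hcw hdy
    exact ⟨hcd, hcr'⟩
  refine ⟨?_, fun q a b c d => (main q a b c d).2⟩
  obtain ⟨q, hq⟩ := exists_notMem_of_card_lt {u, x, y, w} (lt_of_le_of_lt Finset.card_le_four hV)
  simp only [Finset.mem_insert, Finset.mem_singleton, not_or] at hq
  rcases (main q hq.1 hq.2.1 hq.2.2.1 hq.2.2.2).1.symm with h5 | h5
  · rcases h5 with h5 | h5
    · exact absurd h5.1.symm hxy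
    · exact Edge.of_second (u := u) (x := y) (List.nodup_cons.1 h.nodup).2 (Or.inl h5) hwu
  · exact absurd (h5.left_unique h.nodup (Or.inr (Or.inl ⟨rfl, rfl⟩))) hwu

/-- After rotating at `w` as well, the new end `y` has two further available points. -/
lemma PlaneList.exists_avail_of_hidden_hidden (hφ : Generic φ)
    (h : PlaneList φ (y :: u :: x :: w :: B)) (hV : 5 ≤ Fintype.card V) (hwy : w ≠ y)
    (hcrw : Crosses (φ u) (φ w) (φ x) (φ y))
    (hcr : ∀ q, q ≠ u → q ≠ x → q ≠ y → q ≠ w → Crosses (φ x) (φ q) (φ w) (φ y)) :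
    ∃ t, Avail φ (y :: u :: x :: w :: B) y t ∧ t ≠ x ∧ t ≠ w := by
  classical
  obtain ⟨q, hq⟩ := exists_notMem_of_card_lt {u, x, y, w} (lt_of_le_of_lt Finset.card_le_four hV)
  simp only [Finset.mem_insert, Finset.mem_singleton, not_or] at hq
  obtain ⟨hqu, hqx, hqy, hqw⟩ := hq
  by_cases hs : Sees φ (Edge (y :: u :: x :: w :: B)) y q
  · exact ⟨q, avail_cons_iff.2 ⟨hqy, hqu, hs⟩, hqx, hqw⟩
  obtain ⟨c, d, p, r, -, -, -, hp, -, -, hr, -, hrp, hps, hrs⟩ :=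
    exists_sees_of_not_sees hφ h.uncrossed (Ne.symm hqy) hs
  have hpy : p ≠ y := by rintro rfl; simp at hp
  have hry : r ≠ y := by rintro rfl; simp at hr
  by_contra hn
  push Not at hn
  have hseen : ∀ z, z ≠ y → Sees φ (Edge (y :: u :: x :: w :: B)) y z →
      z = u ∨ z = x ∨ z = w := by
    intro z hz hzs
    by_contra hzn
    push Not at hzn
    exact hzn.2.2 (hn z (avail_cons_iff.2 ⟨hz, hzn.1, hzs⟩) hzn.2.1)
  have hq1 : area (φ y) (φ w) (φ q) * area (φ y) (φ w) (φ x) < 0 := by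
    have := (hcr q hqu hqx hqy hqw).2
    rw [area_swap (φ y) (φ w), area_swap (φ y) (φ w)] at this
    linarith
  -- `u w` and `x y` are diagonals of a convex quadrilateral with side `y w`, so `u` lies on the
  -- side of `x`, away from `q`.
  have hu1 : 0 < area (φ y) (φ w) (φ u) * area (φ y) (φ w) (φ x) := by
    have := hcrw.swap_left.swap_right.same_side
    rw [area_swap (φ y) (φ w), area_swap (φ y) (φ w)] at this
    linarith
  have hz1 : ∀ z, z = u ∨ z = x ∨ z = w →
      0 ≤ area (φ y) (φ w) (φ z) * area (φ y) (φ w) (φ x) := by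
    rintro z (rfl | rfl | rfl)
    · exact hu1.le
    · exact mul_self_nonneg _
    · simp
  have hp1 := hz1 p (hseen p hpy hps)
  have hr1 := hz1 r (hseen r hry hrs)
  -- Seen from `y`, the direction of `q` is a positive combination of those of `r` and `p`. If both
  -- lie in the closed half-plane of `x`, then so does `q`, a contradiction.
  have e : area (φ y) (φ r) (φ p) * (area (φ y) (φ w) (φ q) * area (φ y) (φ w) (φ x)) =
      area (φ y) (φ q) (φ p) * (area (φ y) (φ w) (φ r) * area (φ y) (φ w) (φ x)) +
      area (φ y) (φ r) (φ q) * (area (φ y) (φ w) (φ p) * area (φ y) (φ w) (φ x)) := by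
    unfold area; ring
  have h1 := mul_neg_of_pos_of_neg hrp hq1
  have h2 := mul_nonneg hp.le hr1
  have h3 := mul_nonneg hr.le hp1
  linarith

end Endpoint

/-! ### Five paths by rotations at one end. -/

section Rotations

variable {V : Type*} {φ : V → ℝ × ℝ} {l l₁ l₂ : List V} {u x y : V}

/-- `l'` arises from the plane spanning path `l` by one rotation at its first vertex. -/
def RotStep (φ : V → ℝ × ℝ) (l l' : List V) : Prop :=
  PlaneList φ l ∧ PlaneList φ l' ∧ ∃ u y x, Rot l u y x l'

/-- Connectedness by rotations at the first vertex. -/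
abbrev RotReach (φ : V → ℝ × ℝ) : List V → List V → Prop := Relation.ReflTransGen (RotStep φ)

lemma RotReach.getLast? (h : RotReach φ l l₁) : l₁.getLast? = l.getLast? := by
  induction h with
  | refl => rfl
  | tail _ h ih =>
    obtain ⟨-, -, u, y, x, hr⟩ := h
    rw [hr.getLast?, ih]

lemma RotReach.planeList (h : RotReach φ l l₁) (hl : PlaneList φ l) : PlaneList φ l₁ := by
  induction h with
  | refl => exact hl
  | tail _ h _ => exact h.2.1

variable [Fintype V]

/-- When the way back is the only rotation of `l₁`, the vertex `y` is third in `l₁`; so the rotation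
merely exchanged the first two vertices of `l`. -/
lemma PlaneList.hidden_of_rot (hφ : Generic φ) (h : PlaneList φ l₁) (hl : PlaneList φ l)
    (hV : 4 ≤ Fintype.card V) (hr : Rot l u y x l₁) (huniq : ∀ z, Avail φ l₁ x z → z = y) :
    ∃ B, l = u :: x :: y :: B ∧
      ∀ q, q ≠ x → q ≠ u → q ≠ y → Crosses (φ x) (φ q) (φ u) (φ y) := by
  have ha := hr.avail hl
  have hc := hr.symm.consec
  obtain ⟨b, B, rfl, -⟩ := id ha
  obtain ⟨⟨B', rfl⟩, hcr⟩ := h.third_of_unique_avail hφ hV ha huniq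
  have hub : b = u :=
    Consec.left_unique h.nodup (Or.inr (Or.inl ⟨rfl, rfl⟩)) hc
  subst hub
  obtain ⟨A, C, h1, h2⟩ := hr.symm
  cases A with
  | nil =>
    simp only [List.nil_append, List.cons.injEq, true_and] at h1
    subst h1
    exact ⟨B', by simpa using h2, hcr⟩
  | cons a A =>
    simp only [List.cons_append, List.cons.injEq, true_and] at h1
    obtain ⟨rfl, h1⟩ := h1
    have := (List.nodup_cons.1 (List.nodup_cons.1 h.nodup).2).1
    rw [h1] at this
    simp at this

/-- If the end has only one available vertex, exchanging the first two vertices is a rotation, and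
the new end sees a further vertex besides the way back. -/
lemma exists_two_avail (hφ : Generic φ) (hV : 4 ≤ Fintype.card V) (hl : PlaneList φ l) :
    ∃ p u y z, RotReach φ l p ∧ PlaneList φ p ∧ Avail φ p u y ∧ Avail φ p u z ∧ y ≠ z := by
  obtain ⟨u, x, B, rfl⟩ := hl.exists_cons_cons (by omega)
  obtain ⟨y, hy⟩ := hl.exists_avail hφ (by omega)
  by_cases huniq : ∀ z, Avail φ (u :: x :: B) u z → z = y
  · obtain ⟨⟨B, rfl⟩, hcr⟩ := hl.third_of_unique_avail hφ hV hy huniq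
    have hr : Rot (u :: x :: y :: B) u y x (x :: u :: y :: B) := ⟨[], B, rfl, rfl⟩
    have hp := hl.rot hr (avail_cons_iff.1 hy).2.2
    have hay := hr.avail hl
    obtain ⟨w, hw, hwy⟩ := hp.exists_avail_of_hidden hφ hV (avail_cons_iff.1 hay).2.2 hcr
    exact ⟨_, x, w, y, .single ⟨hl, hp, _, _, _, hr⟩, hp, hw, hay, hwy⟩
  · push Not at huniq
    obtain ⟨z, hz, hzy⟩ := huniq
    exact ⟨_, u, z, y, .refl, hl, hz, hy, hzy⟩

/-- Here `l₁` is a dead end. If `l` has a third rotation, this and a step beyond `l₂` complete the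
five. If `l` has just two, rigidity fixes its first four vertices, and two different steps lead on
from `l₂`. -/
lemma five_of_leaf (hφ : Generic φ) (hV : 5 ≤ Fintype.card V) (hl : PlaneList φ l) {y₂ : V}
    (hne : y ≠ y₂) (h₁ : PlaneList φ l₁) (hr₁ : Rot l u y x l₁) (ha : Avail φ l u y)
    (ha₂ : Avail φ l u y₂) (huniq : ∀ z, Avail φ l₁ x z → z = y) :
    ∃ L : List (List V), L.Nodup ∧ L.length = 5 ∧ ∀ q ∈ L, RotReach φ l q := by
  have step₁ : RotReach φ l l₁ := .single ⟨hl, h₁, _, _, _, hr₁⟩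
  have n₁ := (hr₁.list_ne hl.nodup).symm
  by_cases h3 : ∃ y₃, Avail φ l u y₃ ∧ y₃ ≠ y ∧ y₃ ≠ y₂
  · obtain ⟨y₃, ha₃, hn1, hn2⟩ := h3
    obtain ⟨x₂, l₂, hr₂, h₂, -⟩ := ha₂.exists_rot hl
    obtain ⟨x₃, l₃, hr₃, h₃, -⟩ := ha₃.exists_rot hl
    -- If `l₂` were a dead end too, the third vertex of `l` would be both `y` and `y₂`.
    obtain ⟨z, hz, hzy⟩ : ∃ z, Avail φ l₂ x₂ z ∧ z ≠ y₂ := by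
      by_contra hn
      push Not at hn
      obtain ⟨B, e1, -⟩ := h₁.hidden_of_rot hφ hl (by omega) hr₁ huniq
      obtain ⟨B', e2, -⟩ := h₂.hidden_of_rot hφ hl (by omega) hr₂ hn
      rw [e1] at e2
      simp only [List.cons.injEq, true_and] at e2
      exact hne e2.2.1
    obtain ⟨w, q, hq, hqp, -⟩ := hz.exists_rot h₂
    have hedge := hr₂.edge_of_rot hl.nodup hq hzy
    have step₂ : RotReach φ l l₂ := .single ⟨hl, h₂, _, _, _, hr₂⟩
    refine ⟨[l, l₁, l₂, l₃, q], ?_, rfl, ?_⟩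
    · have n₂ := (hr₂.list_ne hl.nodup).symm
      have n₃ := (hr₃.list_ne hl.nodup).symm
      have n₁₂ := hr₁.ne_of_rot hl.nodup hr₂ hne.symm
      have n₁₃ := hr₁.ne_of_rot hl.nodup hr₃ hn1
      have n₂₃ := hr₂.ne_of_rot hl.nodup hr₃ hn2
      have m : l ≠ q := by rintro rfl; exact hr₂.not_edge hl.nodup hedge
      have m₁ : l₁ ≠ q := by
        rintro rfl; exact hr₂.not_edge_of_rot hl.nodup hr₁ hne hedge
      have m₂ := (hq.list_ne h₂.nodup).symm
      have m₃ : l₃ ≠ q := by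
        rintro rfl; exact hr₂.not_edge_of_rot hl.nodup hr₃ hn2 hedge
      simp [n₁, n₂, n₃, n₁₂, n₁₃, n₂₃, m, m₁, m₂, m₃]
    · simp only [List.mem_cons, List.not_mem_nil, or_false]
      rintro q' (rfl | rfl | rfl | rfl | rfl)
      · exact .refl
      · exact step₁
      · exact step₂
      · exact .single ⟨hl, h₃, _, _, _, hr₃⟩
      · exact step₂.tail ⟨h₂, hqp, _, _, _, hq⟩
  · push Not at h3
    obtain ⟨B, rfl, hcr⟩ := h₁.hidden_of_rot hφ hl (by omega) hr₁ huniq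
    obtain ⟨⟨B, rfl⟩, hcr₂⟩ := hl.fourth_of_hidden hφ hV hcr ha₂ hne.symm
      (fun z hz => or_iff_not_imp_left.2 (h3 z hz))
    obtain ⟨hy₂u, hy₂x, hs₂⟩ := avail_cons_iff.1 ha₂
    obtain ⟨hyu, hyx, hs⟩ := avail_cons_iff.1 ha
    have hr₂ : Rot (u :: x :: y :: y₂ :: B) u y₂ y (y :: x :: u :: y₂ :: B) :=
      ⟨[x], B, rfl, rfl⟩
    have h₂ := hl.rot hr₂ hs₂
    obtain ⟨t, ht, htu, hty₂⟩ := h₂.exists_avail_of_hidden_hidden hφ hV hne.symm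
      (hcr y₂ hy₂x hy₂u hne.symm) hcr₂
    -- The edge `u y` was available in `l`, and it shares `u` with the one new edge `u y₂`.
    have hau : Avail φ (y :: x :: u :: y₂ :: B) y u := by
      refine avail_cons_iff.2 ⟨hyu.symm, (hr₁.ne hl.nodup).2, fun a b hab hc => ?_⟩
      rcases hr₂.edge hab with h4 | ⟨rfl, rfl⟩ | ⟨rfl, rfl⟩
      · exact hs a b h4 hc.swap_left
      · exact not_crosses_share _ _ _ hc.swap_left
      · exact not_crosses_share _ _ _ hc.swap_left.swap_right
    obtain ⟨w, q, hq, hqp, -⟩ := ht.exists_rot h₂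
    obtain ⟨w', q', hq', hqp', -⟩ := hau.exists_rot h₂
    -- The edge `u y₂` separates `q` and `q'` from `l` and `l₁`, which lack it.
    have hedge := hr₂.edge_of_rot hl.nodup hq hty₂
    have hedge' := hr₂.edge_of_rot hl.nodup hq' hy₂u.symm
    have step₂ : RotReach φ _ _ := .single ⟨hl, h₂, _, _, _, hr₂⟩
    refine ⟨[u :: x :: y :: y₂ :: B, l₁, y :: x :: u :: y₂ :: B, q, q'], ?_, rfl, ?_⟩
    rotate_left
    · simp only [List.mem_cons, List.not_mem_nil, or_false]
      rintro p (h | h | h | h | h)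
      · subst h; exact .refl
      · subst h; exact step₁
      · subst h; exact step₂
      · subst h; exact step₂.tail ⟨h₂, hqp, _, _, _, hq⟩
      · subst h; exact step₂.tail ⟨h₂, hqp', _, _, _, hq'⟩
    · have n₂ := (hr₂.list_ne hl.nodup).symm
      have n₁₂ := hr₁.ne_of_rot hl.nodup hr₂ hne.symm
      generalize (u :: x :: y :: y₂ :: B) = l at *
      generalize (y :: x :: u :: y₂ :: B) = l₂ at *
      have m : l ≠ q := by rintro rfl; exact hr₂.not_edge hl.nodup hedge
      have m' : l ≠ q' := by rintro rfl; exact hr₂.not_edge hl.nodup hedge'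
      have m₁ : l₁ ≠ q := by
        rintro rfl; exact hr₂.not_edge_of_rot hl.nodup hr₁ hne hedge
      have m₁' : l₁ ≠ q' := by
        rintro rfl; exact hr₂.not_edge_of_rot hl.nodup hr₁ hne hedge'
      have m₂ := (hq.list_ne h₂.nodup).symm
      have m₂' := (hq'.list_ne h₂.nodup).symm
      have m₃ := hq.ne_of_rot h₂.nodup hq' htu.symm
      simp [n₁, n₂, n₁₂, m, m', m₁, m₁', m₂, m₂', m₃]

/-- There are at least five plane spanning paths that arise from a given one by rotations
keeping its last vertex. -/
lemma exists_five (hφ : Generic φ) (hV : 5 ≤ Fintype.card V) (hl : PlaneList φ l) :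
    ∃ L : List (List V), L.Nodup ∧ L.length = 5 ∧ ∀ q ∈ L, RotReach φ l q := by
  obtain ⟨p, u, y₁, y₂, hlp, hp, ha₁, ha₂, hne⟩ := exists_two_avail hφ (by omega) hl
  suffices H : ∃ L : List (List V), L.Nodup ∧ L.length = 5 ∧ ∀ q ∈ L, RotReach φ p q by
    obtain ⟨L, h1, h2, h3⟩ := H
    exact ⟨L, h1, h2, fun q hq => hlp.trans (h3 q hq)⟩
  obtain ⟨x₁, l₁, hr₁, h₁, -⟩ := ha₁.exists_rot hp
  obtain ⟨x₂, l₂, hr₂, h₂, -⟩ := ha₂.exists_rot hp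
  by_cases hu₁ : ∀ z, Avail φ l₁ x₁ z → z = y₁
  · exact five_of_leaf hφ hV hp hne h₁ hr₁ ha₁ ha₂ hu₁
  by_cases hu₂ : ∀ z, Avail φ l₂ x₂ z → z = y₂
  · exact five_of_leaf hφ hV hp hne.symm h₂ hr₂ ha₂ ha₁ hu₂
  push Not at hu₁ hu₂
  obtain ⟨z₁, hz₁, hzy₁⟩ := hu₁
  obtain ⟨z₂, hz₂, hzy₂⟩ := hu₂
  obtain ⟨w₁, q₁, hq₁, hqp₁, -⟩ := hz₁.exists_rot h₁
  obtain ⟨w₂, q₂, hq₂, hqp₂, -⟩ := hz₂.exists_rot h₂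
  have hedge₁ := hr₁.edge_of_rot hp.nodup hq₁ hzy₁
  have hedge₂ := hr₂.edge_of_rot hp.nodup hq₂ hzy₂
  have step₁ : RotReach φ p l₁ := .single ⟨hp, h₁, _, _, _, hr₁⟩
  have step₂ : RotReach φ p l₂ := .single ⟨hp, h₂, _, _, _, hr₂⟩
  refine ⟨[p, l₁, l₂, q₁, q₂], ?_, rfl, ?_⟩
  · have n₁ := (hr₁.list_ne hp.nodup).symm
    have n₂ := (hr₂.list_ne hp.nodup).symm
    have n₁₂ := hr₁.ne_of_rot hp.nodup hr₂ hne.symm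
    have m₁ : p ≠ q₁ := by rintro rfl; exact hr₁.not_edge hp.nodup hedge₁
    have m₂ : p ≠ q₂ := by rintro rfl; exact hr₂.not_edge hp.nodup hedge₂
    have k₁ := (hq₁.list_ne h₁.nodup).symm
    have k₂ := (hq₂.list_ne h₂.nodup).symm
    have k₁₂ : l₁ ≠ q₂ := by
      rintro rfl; exact hr₂.not_edge_of_rot hp.nodup hr₁ hne hedge₂
    have k₂₁ : l₂ ≠ q₁ := by
      rintro rfl; exact hr₁.not_edge_of_rot hp.nodup hr₂ hne.symm hedge₁
    have j := Rot.two_step_ne hp.nodup hr₁ hr₂ hne hq₁ hq₂ hzy₁ hzy₂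
    simp [n₁, n₂, n₁₂, m₁, m₂, k₁, k₂, k₁₂, k₂₁, j]
  · simp only [List.mem_cons, List.not_mem_nil, or_false]
    rintro q (rfl | rfl | rfl | rfl | rfl)
    · exact .refl
    · exact step₁
    · exact step₂
    · exact step₁.tail ⟨h₁, hqp₁, _, _, _, hq₁⟩
    · exact step₂.tail ⟨h₂, hqp₂, _, _, _, hq₂⟩

end Rotations

/-! ### From five paths to fifteen vertex lists. -/

section Count

variable {V : Type*} {φ : V → ℝ × ℝ} {l l' l₁ l₂ : List V} {u x y : V}

lemma consec_iff_getElem? {a b : V} :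
    Consec l a b ↔ ∃ i, l[i]? = some a ∧ l[i + 1]? = some b := by
  induction l with
  | nil => simp [Consec]
  | cons x l ih =>
    cases l with
    | nil => simp [Consec]
    | cons y l =>
      rw [Consec, ih]
      constructor
      · rintro (⟨rfl, rfl⟩ | ⟨i, h1, h2⟩)
        · exact ⟨0, by simp⟩
        · exact ⟨i + 1, by simpa using h1, by simpa using h2⟩
      · rintro ⟨_ | i, h1, h2⟩
        · left
          simp only [List.getElem?_cons_zero, Option.some.injEq, zero_add,
            List.getElem?_cons_succ] at h1 h2
          exact ⟨h1.symm, h2.symm⟩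
        · right
          exact ⟨i, by simpa using h1, by simpa using h2⟩

lemma Rot.unique {x₂ : V} (hl : l.Nodup) (h1 : Rot l u y x l₁) (h2 : Rot l u y x₂ l₂) :
    l₁ = l₂ := by
  have hx := h1.consec.left_unique hl h2.consec
  subst hx
  obtain ⟨A, B, rfl, rfl⟩ := h1
  obtain ⟨A', B', e, rfl⟩ := h2
  simp only [List.cons.injEq, true_and] at e
  have hn := (List.nodup_cons.1 hl).2
  have hA : x ∉ A := fun h => (List.nodup_append.1 hn).2.2 x h x (by simp) rfl
  have hB : x ∉ y :: B := (List.nodup_cons.1 (List.nodup_append.1 hn).2.1).1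
  obtain ⟨rfl, -, e⟩ := (List.append_cons_inj_of_notMem hA hB).1 e
  rw [(List.cons.inj e).2]

/-- The head of `l` is `x`, and `y` is the successor of `u` in `l`. So `u` and `l` alone determine
the inverse rotation. -/
lemma Rot.left_injective (hl : l.Nodup) (h1 : Rot l₁ u y x l) {y₂ x₂ : V}
    (h2 : Rot l₂ u y₂ x₂ l) : l₁ = l₂ := by
  have g1 := h1.symm
  have g2 := h2.symm
  have hx : x = x₂ := by
    obtain ⟨A, B, -, rfl⟩ := h1
    obtain ⟨A', B', -, e⟩ := h2
    simp only [List.cons.injEq] at e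
    exact e.1
  subst hx
  have hy := g1.consec.right_unique hl g2.consec
  subst hy
  exact g1.unique hl g2

lemma edge_tail_iff {A : List V} (hl : (u :: A).Nodup) {a b : V} :
    Edge A a b ↔ Edge (u :: A) a b ∧ a ≠ u ∧ b ≠ u := by
  cases A with
  | nil => simp [Edge, Consec]
  | cons x A =>
    have hu := (List.nodup_cons.1 hl).1
    constructor
    · rintro (h | h)
      · exact ⟨Or.inl (Or.inr h), fun e => hu (e ▸ h.mem_left),
          fun e => hu (e ▸ List.mem_cons_of_mem _ h.mem_right)⟩
      · exact ⟨Or.inr (Or.inr h), fun e => hu (e ▸ List.mem_cons_of_mem _ h.mem_right),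
          fun e => hu (e ▸ h.mem_left)⟩
    · rintro ⟨(h | h) | (h | h), h1, h2⟩
      · exact absurd h.1 h1
      · exact Or.inl h
      · exact absurd h.1 h2
      · exact Or.inr h

/-- The head has a single neighbour, which is therefore the next entry in both lists; remove the
head and repeat. -/
lemma eq_of_edge_iff_of_head {A B : List V} (hA : (u :: A).Nodup) (hB : (u :: B).Nodup)
    (h : ∀ a b, Edge (u :: A) a b ↔ Edge (u :: B) a b) : A = B := by
  induction A generalizing u B with
  | nil =>
    cases B with
    | nil => rfl
    | cons y B =>
      have := (h u y).2 (Or.inl (Or.inl ⟨rfl, rfl⟩))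
      simp [Edge, Consec] at this
  | cons x A ih =>
    have hx := (h u x).1 (Or.inl (Or.inl ⟨rfl, rfl⟩))
    cases B with
    | nil => simp [Edge, Consec] at hx
    | cons y B =>
      obtain rfl := hx.eq_of_head hB
      rw [ih (List.nodup_cons.1 hA).2 (List.nodup_cons.1 hB).2 fun a b => by
        rw [edge_tail_iff hA, edge_tail_iff hB, h]]

/-- A spanning path determines the list of its vertices up to reversal. -/
lemma eq_or_eq_reverse_of_edge_iff (hl : l.Nodup) (hl' : l'.Nodup) (hm : ∀ v, v ∈ l')
    (h : ∀ a b, Edge l a b ↔ Edge l' a b) (hlen : 2 ≤ l.length) : l' = l ∨ l' = l.reverse := by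
  match l, hlen with
  | u :: x :: B, _ =>
    obtain ⟨C, D, rfl⟩ := List.append_of_mem (hm u)
    rcases List.eq_nil_or_concat C with rfl | ⟨C, p, rfl⟩
    · left
      simp only [List.nil_append] at *
      rw [eq_of_edge_iff_of_head hl hl' h]
    cases D with
    | nil =>
      right
      rw [← List.reverse_eq_iff]
      have e : (C.concat p ++ [u]).reverse = u :: p :: C.reverse := by simp
      have hn := List.nodup_reverse.2 hl'
      rw [e] at hn
      rw [e, eq_of_edge_iff_of_head hl hn fun a b => by rw [h, ← edge_reverse, e]]
    | cons q D =>
      -- In the interior of `l'`, `u` has two distinct neighbours, but as head of `l` it has only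
      -- one.
      exfalso
      have hp : Consec (C.concat p ++ u :: q :: D) p u := by
        simp only [List.concat_eq_append, List.append_assoc, List.cons_append, List.nil_append]
        rw [consec_append]
        exact Or.inr (Or.inl ⟨rfl, rfl⟩)
      have hq : Consec (C.concat p ++ u :: q :: D) u q := by
        rw [consec_append]
        exact Or.inr (Or.inl ⟨rfl, rfl⟩)
      have e1 := ((h u p).2 (Or.inr hp)).eq_of_head hl
      have e2 := ((h u q).2 (Or.inl hq)).eq_of_head hl
      have e3 : p = q := e1.trans e2.symm
      rw [← e3] at hq hp hl'
      exact hp.asymm hl' hq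

/-- Connectedness of plane spanning paths by rotations at either end; a path and its reverse
are not distinguished. -/
inductive Linked (φ : V → ℝ × ℝ) (l : List V) : List V → Prop
  | refl : Linked φ l l
  | step {m m' : List V} : Linked φ l m → RotStep φ m m' → Linked φ l m'
  | reverse {m : List V} : Linked φ l m → Linked φ l m.reverse

lemma RotReach.linked (h : RotReach φ l l') : Linked φ l l' := by
  induction h with
  | refl => exact .refl
  | tail _ h ih => exact ih.step h

lemma Linked.planeList (h : Linked φ l l') (hl : PlaneList φ l) : PlaneList φ l' := by
  induction h with
  | refl => exact hl
  | step _ h _ => exact h.2.1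
  | reverse _ ih => exact ih.reverse

/-- At least fifteen vertex lists of plane spanning paths are linked to a given one. -/
lemma exists_fifteen [Fintype V] [DecidableEq V] (hφ : Generic φ) (hV : 5 ≤ Fintype.card V)
    (hl : PlaneList φ l) : ∃ X : Finset (List V), X.card = 15 ∧ ∀ m ∈ X, Linked φ l m := by
  obtain ⟨L, hL, hL5, hreach⟩ := exists_five hφ hV hl
  obtain ⟨v, hv⟩ : ∃ v, l.getLast? = some v := by
    obtain ⟨u, x, B, rfl⟩ := hl.exists_cons_cons (by omega)
    exact ⟨_, List.getLast?_eq_some_getLast (by simp)⟩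
  have hlast : ∀ q ∈ L, q.getLast? = some v := fun q hq => by rw [(hreach q hq).getLast?, hv]
  have hplane : ∀ q ∈ L, PlaneList φ q := fun q hq => (hreach q hq).planeList hl
  have hrev : ∀ q ∈ L, ∃ x B, q.reverse = v :: x :: B := by
    intro q hq
    obtain ⟨w, x, B, e⟩ := (hplane q hq).reverse.exists_cons_cons (by omega)
    have := hlast q hq
    rw [← List.head?_reverse, e] at this
    simp only [List.head?_cons, Option.some.injEq] at this
    exact ⟨x, B, by rw [e, this]⟩
  -- Rotating the reversal at `v` makes `v` interior: the new head differs from `v`, and the last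
  -- entry is the old head of `q`.
  have hrot : ∀ q ∈ L, ∃ W, PlaneList φ W ∧ ∃ y x, Rot q.reverse v y x W := by
    intro q hq
    obtain ⟨x, B, e⟩ := hrev q hq
    have hp := (hplane q hq).reverse
    rw [e] at hp
    obtain ⟨y, hy⟩ := hp.exists_avail hφ (by omega)
    obtain ⟨z, W, hr, hW, -⟩ := hy.exists_rot hp
    exact ⟨W, hW, y, z, by rw [e]; exact hr⟩
  choose! W hWp hW using hrot
  have hhead : ∀ q ∈ L, q.head? ≠ some v := by
    intro q hq h
    obtain ⟨x, B, e⟩ := hrev q hq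
    have hn := (hplane q hq).reverse.nodup
    have e' : q = (v :: x :: B).reverse := by rw [← e, List.reverse_reverse]
    rw [e] at hn
    rw [e', List.head?_reverse, List.getLast?_cons_cons] at h
    exact (List.nodup_cons.1 hn).1 (List.mem_of_getLast? h)
  have hWlast : ∀ q ∈ L, (W q).getLast? ≠ some v := by
    intro q hq
    obtain ⟨y, x, hr⟩ := hW q hq
    rw [hr.getLast?, List.getLast?_reverse]
    exact hhead q hq
  have hWhead : ∀ q ∈ L, (W q).head? ≠ some v := by
    intro q hq
    obtain ⟨y, x, hr⟩ := hW q hq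
    have hne := (hr.ne (hplane q hq).reverse.nodup).2
    obtain ⟨A, B, -, e⟩ := hr
    rw [e]
    simpa using hne.symm
  have hL' : L.toFinset.card = 5 := by rw [List.toFinset_card_of_nodup hL, hL5]
  have c2 : (L.toFinset.image List.reverse).card = 5 := by
    rw [Finset.card_image_of_injective _ List.reverse_injective, hL']
  have c3 : (L.toFinset.image W).card = 5 := by
    rw [Finset.card_image_of_injOn, hL']
    intro q hq q' hq' e
    simp only [List.coe_toFinset, Set.mem_ofPred_eq] at hq hq'
    obtain ⟨y, x, hr⟩ := hW q hq
    obtain ⟨y', x', hr'⟩ := hW q' hq'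
    rw [← e] at hr'
    exact List.reverse_injective (hr.left_injective (hWp q hq).nodup hr')
  have d12 : Disjoint L.toFinset (L.toFinset.image List.reverse) := by
    rw [Finset.disjoint_left]
    intro q hq hq'
    simp only [List.mem_toFinset, Finset.mem_image] at hq hq'
    obtain ⟨q', hq', rfl⟩ := hq'
    apply hhead q' hq'
    rw [← List.getLast?_reverse]
    exact hlast _ hq
  have d3 : Disjoint (L.toFinset ∪ L.toFinset.image List.reverse) (L.toFinset.image W) := by
    rw [Finset.disjoint_left]
    intro q hq hq'
    simp only [Finset.mem_union, List.mem_toFinset, Finset.mem_image] at hq hq'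
    obtain ⟨q', hq', rfl⟩ := hq'
    rcases hq with hq | ⟨p, hp, e⟩
    · exact hWlast q' hq' (hlast _ hq)
    · apply hWhead q' hq'
      rw [← e, List.head?_reverse]
      exact hlast p hp
  refine ⟨(L.toFinset ∪ L.toFinset.image List.reverse) ∪ L.toFinset.image W, ?_, ?_⟩
  · rw [Finset.card_union_of_disjoint d3, Finset.card_union_of_disjoint d12, hL', c2, c3]
  · intro m hm
    simp only [Finset.mem_union, List.mem_toFinset, Finset.mem_image] at hm
    rcases hm with (hm | ⟨q, hq, rfl⟩) | ⟨q, hq, rfl⟩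
    · exact (hreach m hm).linked
    · exact (hreach q hq).linked.reverse
    · obtain ⟨y, x, hr⟩ := hW q hq
      exact (hreach q hq).linked.reverse.step
        ⟨(hplane q hq).reverse, hWp q hq, v, y, x, hr⟩

end Count

/-! ### Translation between plane spanning paths and vertex lists. -/

section Bridge

lemma Crosses.exists_meet {a b c d : ℝ × ℝ} (h : Crosses a b c d) :
    ∃ s t, 0 < s ∧ s < 1 ∧ 0 < t ∧ t < 1 ∧ divide a b s = divide c d t := by
  have key : ∀ p q : ℝ, p * q < 0 → 0 < p / (p - q) ∧ p / (p - q) < 1 ∧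
      (1 - p / (p - q)) * p + p / (p - q) * q = 0 := by
    intro p q hpq
    have hne : p - q ≠ 0 := by
      intro h0
      rw [sub_eq_zero.1 h0] at hpq
      nlinarith [mul_self_nonneg q]
    have e : (1 - p / (p - q)) * p + p / (p - q) * q = 0 := by field_simp; ring
    refine ⟨?_, ?_, e⟩
    · rw [div_pos_iff]
      rcases lt_trichotomy p 0 with hp | rfl | hp
      · exact Or.inr ⟨hp, by nlinarith⟩
      · simp at hpq
      · exact Or.inl ⟨hp, by nlinarith⟩
    · rcases lt_trichotomy p 0 with hp | rfl | hp
      · have : p - q < 0 := by nlinarith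
        rw [div_lt_one_of_neg this]; nlinarith
      · simp at hpq
      · have : 0 < p - q := by nlinarith
        rw [div_lt_one this]; nlinarith
  obtain ⟨hs0, hs1, hs⟩ := key _ _ h.2
  rw [← area_divide] at hs
  have hcd : c ≠ d := by
    rintro rfl
    nlinarith [h.1, mul_self_nonneg (area a b c)]
  obtain ⟨t, ht⟩ := exists_eq_divide hs hcd
  have h0 : (1 - t) * area a b c + t * area a b d = 0 := by
    rw [← area_divide, ← ht, area_divide]; simp
  obtain ⟨ht0, ht1, -⟩ := key _ _ h.1
  have e : t = area a b c / (area a b c - area a b d) := by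
    have hne : area a b c - area a b d ≠ 0 := by
      intro h0
      rw [h0] at ht0; simp at ht0
    rw [eq_div_iff hne]; linarith
  exact ⟨_, t, hs0, hs1, e ▸ ht0, e ▸ ht1, ht⟩

/-- The coordinates of a point of the plane. -/
def coords (p : Plane) : ℝ × ℝ := (p 0, p 1)

lemma coords_injective : Function.Injective coords := by
  intro p q h
  simp only [coords, Prod.mk.injEq] at h
  ext i
  fin_cases i
  · exact h.1
  · exact h.2

lemma mem_segment_iff_coords {p q m : Plane} :
    m ∈ segment ℝ p q ↔ ∃ t, 0 ≤ t ∧ t ≤ 1 ∧ coords m = divide (coords p) (coords q) t := by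
  rw [segment_eq_image']
  simp only [Set.mem_image, Set.mem_Icc, and_assoc]
  refine exists_congr fun t => and_congr_right fun _ => and_congr_right fun _ => ?_
  rw [← coords_injective.eq_iff, eq_comm]
  simp [coords, divide]

lemma generic_of_generalPosition {S : Finset Plane} (hS : GeneralPosition S) :
    Generic (fun v : S => coords v) := by
  intro a b c hab hac hbc h
  refine hS a a.2 b b.2 c c.2 (Subtype.coe_ne_coe.2 hab) (Subtype.coe_ne_coe.2 hac)
    (Subtype.coe_ne_coe.2 hbc) ?_
  obtain ⟨t, ht⟩ := exists_eq_divide h (coords_injective.ne (Subtype.coe_ne_coe.2 hab))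
  rw [collinear_iff_of_mem (p₀ := (a : Plane)) (by simp)]
  refine ⟨(b : Plane) - a, ?_⟩
  simp only [Set.mem_insert_iff, Set.mem_singleton_iff, forall_eq_or_imp, forall_eq, vadd_eq_add]
  refine ⟨⟨0, by simp⟩, ⟨1, by simp⟩, ⟨t, ?_⟩⟩
  apply coords_injective
  refine ht.trans ?_
  simp [coords, divide, add_comm]

/-- In general position, two distinct segments that meet anywhere but at a common endpoint have no
endpoint in common and cross properly, which the strict sign test detects. -/
lemma isPlaneGraph_iff {S : Finset Plane} (hS : GeneralPosition S) (G : SimpleGraph S) :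
    IsPlaneGraph S G ↔ ∀ a b c d, G.Adj a b → G.Adj c d →
      ¬ Crosses (coords a) (coords b) (coords c) (coords d) := by
  have hφ := generic_of_generalPosition hS
  constructor
  · intro h a b c d hab hcd hcr
    obtain ⟨s, t, hs0, hs1, ht0, ht1, hst⟩ := hcr.exists_meet
    let m : Plane := (a : Plane) + s • ((b : Plane) - a)
    have hm : coords m = divide (coords a) (coords b) s := by simp [m, coords, divide]
    have hne : s(a, b) ≠ s(c, d) := by
      intro he
      rcases Sym2.eq_iff.1 he with ⟨rfl, rfl⟩ | ⟨rfl, rfl⟩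
      · exact not_crosses_share _ _ _ hcr
      · exact not_crosses_share _ _ _ hcr.swap_right
    have hmem := h a b c d hab hcd hne
      ⟨mem_segment_iff_coords.2 ⟨s, hs0.le, hs1.le, hm⟩,
        mem_segment_iff_coords.2 ⟨t, ht0.le, ht1.le, hm.trans hst⟩⟩
    have h0 : area (coords c) (coords d) (coords m) = 0 := by
      rw [hm, hst, area_divide]; simp
    have h2 := hcr.2
    rcases hmem.1 with e | e
    · rw [← e, h0] at h2; simp at h2
    · rw [Set.mem_singleton_iff] at e
      rw [← e, h0] at h2; simp at h2
  · rintro h a b c d hab hcd hne m ⟨hm1, hm2⟩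
    obtain ⟨s, hs0, hs1, hs⟩ := mem_segment_iff_coords.1 hm1
    obtain ⟨t, ht0, ht1, ht⟩ := mem_segment_iff_coords.1 hm2
    have hst := hs.symm.trans ht
    have hends : ∀ p q : Plane, coords m = divide (coords p) (coords q) 0 → m = p := by
      intro p q e
      apply coords_injective
      rw [e]; simp [divide]
    by_cases hac : a = c
    · subst hac
      obtain ⟨rfl, rfl⟩ := hφ.eq_of_meet_share hab.ne hcd.ne (fun e => hne (by rw [e])) hst
      rw [hends _ _ hs]; simp
    by_cases had : a = d
    · subst had
      rw [divide_flip (coords c)] at hst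
      obtain ⟨rfl, -⟩ := hφ.eq_of_meet_share hab.ne hac
        (fun e => hne (by rw [e, Sym2.eq_swap])) hst
      rw [hends _ _ hs]; simp
    by_cases hbc : b = c
    · subst hbc
      rw [divide_flip (coords a)] at hst
      obtain ⟨-, rfl⟩ := hφ.eq_of_meet_share hab.ne.symm hcd.ne had hst
      rw [hends _ _ ht]; simp
    by_cases hbd : b = d
    · subst hbd
      rw [divide_flip (coords a), divide_flip (coords c)] at hst
      obtain ⟨e, -⟩ := hφ.eq_of_meet_share hab.ne.symm hcd.ne.symm hac hst
      rw [divide_flip, e] at hs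
      rw [hends _ _ hs]; simp
    exact absurd (hφ.crosses_of_meet hab.ne hcd.ne hac had hbc hbd hs0 hs1 ht0 ht1 hst)
      (h a b c d hab hcd)

/-- The graph whose edges join consecutive entries of a list. -/
def listGraph {V : Type*} (l : List V) : SimpleGraph V where
  Adj a b := a ≠ b ∧ Edge l a b
  symm := ⟨fun _ _ h => ⟨h.1.symm, h.2.symm⟩⟩
  loopless := ⟨fun _ h => h.1 rfl⟩

lemma listGraph_adj {V : Type*} {l : List V} (hl : l.Nodup) {a b : V} :
    (listGraph l).Adj a b ↔ Edge l a b :=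
  ⟨And.right, fun h => ⟨h.ne hl, h⟩⟩

lemma listGraph_reverse {V : Type*} (l : List V) : listGraph l.reverse = listGraph l := by
  ext a b
  simp only [listGraph, edge_reverse]

variable {S : Finset Plane} {l l' : List S}

lemma isSpanningPath_listGraph (hn : l.Nodup) (hm : ∀ v, v ∈ l) :
    IsSpanningPath S (listGraph l) := by
  classical
  have hlen : S.card = l.length := by
    rw [← List.toFinset_card_of_nodup hn, ← Fintype.card_coe, ← Finset.card_univ]
    congr 1
    ext v; simp [hm]
  rw [IsSpanningPath, hlen]
  refine ⟨⟨List.Nodup.getEquivOfForallMemList l hn hm, ?_⟩⟩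
  intro i j
  have key : ∀ i j : Fin l.length, Consec l l[i] l[j] ↔ (i : ℕ) + 1 = j := by
    intro i j
    rw [consec_iff_getElem?]
    constructor
    · rintro ⟨k, h1, h2⟩
      obtain ⟨hk, h1⟩ := List.getElem?_eq_some_iff.1 h1
      obtain ⟨hk', h2⟩ := List.getElem?_eq_some_iff.1 h2
      have e1 := hn.getElem_inj_iff.1 h1
      have e2 := hn.getElem_inj_iff.1 h2
      omega
    · intro h
      refine ⟨i, by simp, ?_⟩
      rw [h]; simp
  rw [SimpleGraph.pathGraph_adj, ← key, ← key]
  exact listGraph_adj hn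

lemma exists_list_of_isSpanningPath {G : SimpleGraph S} (hG : IsSpanningPath S G) :
    ∃ l : List S, l.Nodup ∧ (∀ v, v ∈ l) ∧ listGraph l = G := by
  obtain ⟨e⟩ := hG
  have hn : (List.ofFn e).Nodup := List.nodup_ofFn.2 e.injective
  have key : ∀ a b, Consec (List.ofFn e) a b ↔
      ((e.symm a : Fin S.card) : ℕ) + 1 = (e.symm b : Fin S.card) := by
    intro a b
    rw [consec_iff_getElem?]
    constructor
    · rintro ⟨k, h1, h2⟩
      obtain ⟨hk, h1⟩ := List.getElem?_eq_some_iff.1 h1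
      obtain ⟨hk', h2⟩ := List.getElem?_eq_some_iff.1 h2
      rw [List.getElem_ofFn] at h1 h2
      rw [← h1, ← h2]
      simp
    · intro h
      refine ⟨(e.symm a : Fin S.card), ?_, ?_⟩
      · rw [List.getElem?_ofFn, dif_pos (e.symm a).2]; simp
      · rw [h, List.getElem?_ofFn, dif_pos (e.symm b).2]; simp
  refine ⟨List.ofFn e, hn, fun v => List.mem_ofFn.2 (e.surjective v), ?_⟩
  ext a b
  rw [listGraph_adj hn, Edge, key, key, ← SimpleGraph.pathGraph_adj, e.symm.map_adj_iff]

/-- The plane spanning path with a given list of vertices. -/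
def PlaneList.toPath (hS : GeneralPosition S) (h : PlaneList (fun v : S => coords v) l) :
    PlaneSpanningPath S :=
  ⟨listGraph l, isSpanningPath_listGraph h.nodup h.mem, (isPlaneGraph_iff hS _).2
    fun a b c d h1 h2 => h.not_crosses a b c d h1.2 h2.2⟩

lemma exists_toPath_eq (hS : GeneralPosition S) (P : PlaneSpanningPath S) :
    ∃ (l : List S) (h : PlaneList (fun v : S => coords v) l), h.toPath hS = P := by
  obtain ⟨l, hn, hm, hG⟩ := exists_list_of_isSpanningPath P.2.1
  refine ⟨l, ⟨hn, hm, fun a b c d h1 h2 => ?_⟩, Subtype.ext hG⟩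
  refine (isPlaneGraph_iff hS _).1 P.2.2 a b c d ?_ ?_ <;> rw [← hG, listGraph_adj hn] <;>
    assumption

/-- A rotation exchanges the edge `x y` for `u y`, which is a flip. -/
lemma RotStep.reachable (hS : GeneralPosition S) (h : PlaneList (fun v : S => coords v) l)
    (h' : PlaneList (fun v : S => coords v) l') (hstep : RotStep (fun v : S => coords v) l l') :
    (pathFlipGraph S).Reachable (h.toPath hS) (h'.toPath hS) := by
  obtain ⟨-, -, u, y, x, hr⟩ := hstep
  by_cases he : h.toPath hS = h'.toPath hS
  · rw [he]
  refine SimpleGraph.Adj.reachable ?_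
  rw [pathFlipGraph, SimpleGraph.fromRel_adj]
  refine ⟨he, Or.inl ⟨s(x, y), s(u, y), ?_⟩⟩
  ext e
  induction e with | _ a b
  simp only [PlaneList.toPath, SimpleGraph.mem_edgeSet, listGraph_adj h.nodup,
    listGraph_adj h'.nodup, Set.mem_union, Set.mem_sdiff, Set.mem_singleton_iff, Sym2.eq_iff]
  constructor
  · intro hab
    rcases hr.edge hab with h1 | h1 | h1
    · refine Or.inl ⟨h1, ?_⟩
      have hxy := hr.symm.not_edge h'.nodup
      rintro (⟨rfl, rfl⟩ | ⟨rfl, rfl⟩)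
      · exact hxy hab
      · exact hxy hab.symm
    · exact Or.inr (Or.inl h1)
    · exact Or.inr (Or.inr h1)
  · rintro (⟨h1, h2⟩ | ⟨rfl, rfl⟩ | ⟨rfl, rfl⟩)
    · rcases hr.symm.edge h1 with h3 | h3 | h3
      · exact h3
      · exact absurd (Or.inl h3) h2
      · exact absurd (Or.inr h3) h2
    · exact Or.inl hr.symm.consec
    · exact Or.inr hr.symm.consec

lemma Linked.reachable (hS : GeneralPosition S) (h : PlaneList (fun v : S => coords v) l)
    (hl : Linked (fun v : S => coords v) l l') (h' : PlaneList (fun v : S => coords v) l') :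
    (pathFlipGraph S).Reachable (h.toPath hS) (h'.toPath hS) := by
  induction hl with
  | refl => exact .refl _
  | step hlm hs ih => exact (ih hs.1).trans (hs.reachable hS hs.1 h')
  | @reverse m hlm ih =>
    have e : h'.toPath hS = (hlm.planeList h).toPath hS := Subtype.ext (listGraph_reverse m)
    rw [e]
    exact ih _

end Bridge

/-! ### The final count of paths in a component. -/

/-- For a set `S` of at least five points in general position in the plane, the flip graph of
plane spanning paths on `S` has no connected component with at most `7` vertices. -/
theorem theorem7 (S : Finset Plane) (hS : GeneralPosition S) (hn : 5 ≤ S.card) :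
    ¬ ∃ C : (pathFlipGraph S).ConnectedComponent, C.supp.ncard ≤ 7 := by
  classical
  rintro ⟨C, hC⟩
  induction C using SimpleGraph.ConnectedComponent.ind with | _ P
  obtain ⟨l, hl, rfl⟩ := exists_toPath_eq hS P
  have hV : 5 ≤ Fintype.card S := by rwa [Fintype.card_coe]
  obtain ⟨X, hX, hlink⟩ := exists_fifteen (generic_of_generalPosition hS) hV hl
  set C := (pathFlipGraph S).connectedComponentMk (hl.toPath hS)
  have himage : ((X.image listGraph : Finset (SimpleGraph S)) : Set (SimpleGraph S)) ⊆
      Subtype.val '' C.supp := by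
    intro G hG
    simp only [Finset.coe_image, Set.mem_image, Finset.mem_coe] at hG
    obtain ⟨m, hm, rfl⟩ := hG
    have hmp := (hlink m hm).planeList hl
    refine ⟨hmp.toPath hS, ?_, rfl⟩
    rw [SimpleGraph.ConnectedComponent.mem_supp_iff, SimpleGraph.ConnectedComponent.eq]
    exact ((hlink m hm).reachable hS hl hmp).symm
  have hcard : (X.image listGraph).card ≤ 7 := by
    rw [← Set.ncard_coe_finset]
    refine (Set.ncard_le_ncard himage (Set.toFinite _)).trans ?_
    rwa [Set.ncard_image_of_injective _ Subtype.val_injective]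
  -- Only a list and its reversal give the same path; with at most seven paths there would be at
  -- most fourteen lists, not fifteen.
  have hfiber : X.card ≤ 2 * (X.image listGraph).card := by
    refine Finset.card_le_mul_card_image X 2 fun G hG => ?_
    obtain ⟨m, hm, rfl⟩ := Finset.mem_image.1 hG
    have hmp := (hlink m hm).planeList hl
    refine (Finset.card_le_card (t := {m, m.reverse}) fun m' hm' => ?_).trans Finset.card_le_two
    obtain ⟨hm'X, e⟩ := Finset.mem_filter.1 hm'
    have hmp' := (hlink m' hm'X).planeList hl
    simp only [Finset.mem_insert, Finset.mem_singleton]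
    refine eq_or_eq_reverse_of_edge_iff hmp.nodup hmp'.nodup hmp'.mem (fun a b => ?_)
      (by rw [hmp.length_eq]; omega)
    rw [← listGraph_adj hmp.nodup, ← listGraph_adj hmp'.nodup, e]
  omega
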